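/- **Conventions.** A *type* is a pair $\mathbf t=(t_1,t_2)$ of coprime positive integers; the variables are named so that $t_1\le t_2$. A real polynomial $f(x,y)$ is quasi-homogeneous of type $\mathbf t$ and degree $k\in\mathbb Z$, written $f\in\mathscr P_k^{\mathbf t}$, if $f(\epsilon^{t_1}x,\epsilon^{t_2}y)=\epsilon^k f(x,y)$. A polynomial vector field (or map) $(P,Q)^T$ belongs to $\mathcal Q_k^{\mathbf t}$ if $P\in\mathscr P_{k+t_1}^{\mathbf t}$ and $Q\in\mathscr P_{k+t_2}^{\mathbf t}$. A planar vector field $\mathbf F$, analytic at $\mathbf 0$, with $\mathbf F(\mathbf 0)=\mathbf 0$, is *nilpotent* if its linear part $D\mathbf F(\mathbf 0)$ is nilpotent and nonzero. It is *analytically integrable* if there is a real function $I$, analytic at $\mathbf 0$ and not constant near $\mathbf 0$, with $\nabla I\cdot\mathbf F=0$ near $\mathbf 0$. A *polynomial first integral* of a polynomial field $\mathbf V$ is a nonconstant polynomial $I$ with $\nabla I\cdot\mathbf V=0$. A quasi-homogeneous polynomial first integral $I$ of a field $\mathbf V\in\mathcal Q_r^{\mathbf t}$ is *primitive* if every quasi-homogeneous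 polynomial $J$ of type $\mathbf t$ with $\nabla J\cdot\mathbf V=0$ is of the form $J=cI^l$ with $c\in\mathbb R$ and an integer $l\ge 0$. **Proposition.** Let $\mathbf F=\sum_{j\ge r}\mathbf F_j$, $r\in\mathbb Z$, $\mathbf F_j\in\mathcal Q_j^{\mathbf t}$, be a nilpotent vector field, analytic at the origin of $\mathbb R^2$, such that the origin is an isolated singular point of $\dot{\mathbf x}=\mathbf F_r(\mathbf x)$. If $\mathbf F$ is analytically integrable, then there exists $\Phi_0\in\mathcal Q_0^{\mathbf t}$ with $\det D\Phi_0(\mathbf 0)\ne0$ such that the transformed field $\mathbf G:=(\Phi_0)_*\mathbf F$ (that is, $\mathbf G(\Phi_0(\mathbf x))=D\Phi_0(\mathbf x)\,\mathbf F(\mathbf x)$ near $\mathbf 0$) is analytic at $\mathbf 0$ and has an expansion $\mathbf G=\mathbf G_r+\cdots$, where $\mathbf G_r\in\mathcal Q_r^{\mathbf t}$, the dots are quasi-homogeneous terms of type $\mathbf t$ and degree greater than $r$, and, for some integer $n\ge1$, one of the following holds. * (i) $\mathbf t=(2,2n+1)$, $r=2n-1$, $\mathbf G_r=(y,\,x^{2n})^T$,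 and $2x^{2n+1}-(2n+1)y^2\in\mathscr P^{\mathbf t}_{2(2n+1)}$ is a primitive first integral of $\mathbf G_r$. * (ii) $\mathbf t=(1,n+1)$, $r=n$, $\mathbf G_r=(y,\,\sigma(n+1)x^{2n+1})^T$ with $\sigma=\pm1$, and $-\sigma x^{2n+2}+y^2\in\mathscr P^{\mathbf t}_{2(n+1)}$ is a primitive first integral of $\mathbf G_r$. * (iii) $\mathbf t=(1,n+1)$, $r=n$, $\mathbf G_r=(y,\,(n+1)x^{2n+1})^T+d\,x^n\,(x,\,(n+1)y)^T$ with $d=\frac{m_1-m_2}{m_1+m_2}\neq0$ for some coprime positive integers $m_1,m_2$, and $I_M=(y-x^{n+1})^{m_1}(y+x^{n+1})^{m_2}\in\mathscr P^{\mathbf t}_{M}$, $M=(n+1)(m_1+m_2)$, is a primitive first integral of $\mathbf G_r$. -/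

import Mathlib

open Filter Topology MvPolynomial

/-- The real plane, with coordinates `x = p 0` and `y = p 1`. -/
abbrev Plane : Type := Fin 2 → ℝ

/-- Real polynomials in the two variables `x = X 0` and `y = X 1`. -/
abbrev PlanePoly : Type := MvPolynomial (Fin 2) ℝ

/-- A polynomial vector field on (or polynomial map of) the plane, given by its components. -/
abbrev PolyField : Type := Fin 2 → PlanePoly

/-- The map of the plane defined by a polynomial vector field. -/
noncomputable def PolyField.toMap (V : PolyField) (p : Plane) : Plane :=
  fun i => eval p (V i)

/-- The Jacobian matrix of a polynomial map at a point. -/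
noncomputable def PolyField.jacobian (V : PolyField) (p : Plane) : Matrix (Fin 2) (Fin 2) ℝ :=
  Matrix.of fun i j => eval p (pderiv j (V i))

/-- `f` is a quasi-homogeneous polynomial of type `t` and degree `k`: every monomial
`x ^ a * y ^ b` of `f` satisfies `t 0 * a + t 1 * b = k`. -/
def IsQuasiHom (t : Fin 2 → ℕ) (k : ℤ) (f : PlanePoly) : Prop :=
  IsWeightedHomogeneous (fun i => (t i : ℤ)) f k

/-- `V` is a quasi-homogeneous vector field of type `t` and degree `k`: its `i`-th component is
quasi-homogeneous of degree `k + t i`. -/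
def IsQuasiHomField (t : Fin 2 → ℕ) (k : ℤ) (V : PolyField) : Prop :=
  ∀ i, IsQuasiHom t (k + t i) (V i)

/-- `F` is a vector field, analytic at the origin, whose quasi-homogeneous expansion of type `t`
is `F = V 0 + V 1 + V 2 + ⋯`, where `V k` is quasi-homogeneous of degree `r + k`. -/
structure HasQuasiHomExpansion (t : Fin 2 → ℕ) (r : ℤ) (F : Plane → Plane)
    (V : ℕ → PolyField) : Prop where
  analyticAt : AnalyticAt ℝ F 0
  quasiHom : ∀ k : ℕ, IsQuasiHomField t (r + k) (V k)
  hasSum : ∀ᶠ p in 𝓝 (0 : Plane), HasSum (fun k => (V k).toMap p) (F p)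

/-- The origin is a nilpotent singular point of `F`: the linear part of `F` there is nilpotent
and not zero. -/
def IsNilpotentSingularity (F : Plane → Plane) : Prop :=
  F 0 = 0 ∧ fderiv ℝ F 0 ≠ 0 ∧ IsNilpotent (fderiv ℝ F 0)

/-- The origin is an isolated singular point of `F`. -/
def IsIsolatedSingularity (F : Plane → Plane) : Prop :=
  F 0 = 0 ∧ ∀ᶠ p in 𝓝[≠] (0 : Plane), F p ≠ 0

/-- `F` has an analytic first integral in a neighbourhood of the origin: a function analytic at
the origin, not constant near it, and annihilated by `F`. -/
def IsAnalyticallyIntegrable (F : Plane → Plane) : Prop :=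
  ∃ I : Plane → ℝ, AnalyticAt ℝ I 0 ∧ (¬ ∀ᶠ p in 𝓝 (0 : Plane), I p = I 0) ∧
    ∀ᶠ p in 𝓝 (0 : Plane), fderiv ℝ I p (F p) = 0

/-- `G` is, near the origin, the transform `Φ_* F` of the vector field `F` by the change of
variables `Φ`, that is, `G (Φ p) = DΦ(p) (F p)`. -/
def IsPushforward (Φ : PolyField) (F G : Plane → Plane) : Prop :=
  ∀ᶠ p in 𝓝 (0 : Plane), G (Φ.toMap p) = (Φ.jacobian p).mulVec (F p)

/-- The derivative `∇ I · V` of the polynomial `I` along the polynomial vector field `V`. -/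
noncomputable def PolyField.lieDeriv (V : PolyField) (I : PlanePoly) : PlanePoly :=
  ∑ i, pderiv i I * V i

/-- `I` is a polynomial first integral of `V`; constants are not first integrals. -/
def IsPolyFirstIntegral (V : PolyField) (I : PlanePoly) : Prop :=
  (∀ c : ℝ, I ≠ C c) ∧ V.lieDeriv I = 0

/-- `I` is a primitive first integral of `V`, with respect to the type `t`: it is a quasi-homogeneous
polynomial first integral of some degree `M`, and every quasi-homogeneous polynomial annihilated by
`V` is a constant times a power of `I`. In particular `I` is not a proper power of a
first integral and has the least possible degree. -/
def IsPrimitiveFirstIntegral (t : Fin 2 → ℕ) (V : PolyField) (M : ℤ) (I : PlanePoly) : Prop :=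
  IsQuasiHom t M I ∧ IsPolyFirstIntegral V I ∧
    ∀ (k : ℤ) (J : PlanePoly), IsQuasiHom t k J → V.lieDeriv J = 0 →
      ∃ (c : ℝ) (l : ℕ), J = C c * I ^ l

/-! Everything is read off along the dilations: after rescaling, `F` tends to its leading part `V 0`
(`HasQuasiHomExpansion.tendsto_leading`). Comparison with the linear part of `F` on the axes,
together with the isolated zero of `V 0`, forces `t 0 < t 1` and `r = t 1 - t 0`
(`HasQuasiHomExpansion.degree_eq`). Nonvanishing on the x-axis then gives `t 0 ∣ 2`
(`HasQuasiHomExpansion.type_eq`). In these degrees very few monomials exist, and a quasi-homogeneous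
shear brings `V 0` either to the cusp form, with no parameter left, or to `nodeField n s d` with `s
∈ {0, 1, -1}` (`exists_shear_cusp`, `exists_shear_node`).

Integrability restricts `s` and `d`. The lowest quasi-homogeneous form of an analytic first integral
is a first integral `J` of the leading part (`IsAnalyticallyIntegrable.exists_quasiHom`). On the
line `x = 1`, Euler's identity turns the vanishing of the Lie derivative of `J` into a first-order
linear equation `q j' = p j` in one variable. At a simple zero `z` of `q`, the residue of `j'/j` is
the multiplicity of `z` in `j`, a natural number (`rootMultiplicity_of_ode`). For the node forms
these residues exclude `s = 0`, force `d = 0` when `s = -1`, and make `(1 + d) : (1 - d)` a ratio of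
positive integers when `s = 1` (`nodeField_parameters`).

The same residues give primitivity: they force the degree of every quasi-homogeneous first integral
to be a multiple of the degree of `I`, and in a given degree the linear equation has at most one
solution up to a scalar (`isPrimitiveFirstIntegral_of_degree`). -/

/-- The quasi-homogeneous dilation `(x, y) ↦ (ε ^ t 0 * x, ε ^ t 1 * y)`. -/
def dilate (t : Fin 2 → ℕ) (ε : ℝ) (p : Plane) : Plane := fun i => ε ^ t i * p i

theorem weight_eq (t : Fin 2 → ℕ) (m : Fin 2 →₀ ℕ) :
    Finsupp.weight (fun i => (t i : ℤ)) m = t 0 * m 0 + t 1 * m 1 := by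
  rw [Finsupp.weight_apply, Finsupp.sum_fintype _ _ (by simp)]
  simp [mul_comm]

theorem prod_dilate (t : Fin 2 → ℕ) {ε : ℝ} (hε : ε ≠ 0) (p : Plane) (m : Fin 2 →₀ ℕ) :
    ∏ i, dilate t ε p i ^ m i =
      ε ^ (Finsupp.weight (fun i => (t i : ℤ)) m) * ∏ i, p i ^ m i := by
  rw [weight_eq, zpow_add₀ hε, zpow_mul, zpow_mul]
  simp only [zpow_natCast, Fin.prod_univ_two, dilate, mul_pow]
  ring

theorem IsQuasiHom.eval_dilate {t : Fin 2 → ℕ} {k : ℤ} {f : PlanePoly} (hf : IsQuasiHom t k f)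
    {ε : ℝ} (hε : ε ≠ 0) (p : Plane) : eval (dilate t ε p) f = ε ^ k * eval p f := by
  rw [eval_eq', eval_eq', Finset.mul_sum]
  refine Finset.sum_congr rfl fun m hm => ?_
  rw [prod_dilate t hε, hf (mem_support_iff.1 hm)]
  ring

/-- Euler's identity for quasi-homogeneous polynomials. -/
theorem IsQuasiHom.euler {t : Fin 2 → ℕ} {k : ℤ} {f : PlanePoly} (hf : IsQuasiHom t k f) :
    C (t 0 : ℝ) * (X 0 * pderiv 0 f) + C (t 1 : ℝ) * (X 1 * pderiv 1 f) = C (k : ℝ) * f := by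
  induction hf using IsWeightedHomogeneous.induction_on with
  | zero => simp
  | add p q _ _ hp hq => simp only [map_add, mul_add, ← hp, ← hq]; ring
  | monomial d r h =>
    rw [weight_eq] at h
    rw [X_mul_pderiv_monomial, X_mul_pderiv_monomial, ← h]
    simp only [nsmul_eq_mul, Int.cast_add, Int.cast_mul, Int.cast_natCast, map_add, map_mul,
      map_natCast]
    ring

/-! ### Lie derivatives along polynomial fields -/

theorem PolyField.lieDeriv_eq (V : PolyField) (I : PlanePoly) :
    V.lieDeriv I = pderiv 0 I * V 0 + pderiv 1 I * V 1 := by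
  simp [PolyField.lieDeriv, Fin.sum_univ_two]

theorem PolyField.lieDeriv_eq_mkDerivation (V : PolyField) (I : PlanePoly) :
    V.lieDeriv I = mkDerivation ℝ V I := by
  have h : (V 0 • pderiv 0 + V 1 • pderiv 1 : Derivation ℝ PlanePoly PlanePoly) =
      mkDerivation ℝ V := by
    refine MvPolynomial.derivation_ext fun i => ?_
    fin_cases i <;> simp [mkDerivation_X, pderiv_X]
  rw [← h, V.lieDeriv_eq]
  simp [mul_comm]

@[simp]
theorem PolyField.lieDeriv_X (V : PolyField) (i : Fin 2) : V.lieDeriv (X i) = V i := by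
  rw [lieDeriv_eq_mkDerivation, mkDerivation_X]

@[simp]
theorem PolyField.lieDeriv_C (V : PolyField) (c : ℝ) : V.lieDeriv (C c) = 0 := by
  rw [lieDeriv_eq_mkDerivation, derivation_C]

theorem PolyField.lieDeriv_add (V : PolyField) (f g : PlanePoly) :
    V.lieDeriv (f + g) = V.lieDeriv f + V.lieDeriv g := by
  simp only [lieDeriv_eq_mkDerivation, map_add]

theorem PolyField.lieDeriv_sub (V : PolyField) (f g : PlanePoly) :
    V.lieDeriv (f - g) = V.lieDeriv f - V.lieDeriv g := by
  simp only [lieDeriv_eq_mkDerivation, map_sub]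

theorem PolyField.lieDeriv_mul (V : PolyField) (f g : PlanePoly) :
    V.lieDeriv (f * g) = f * V.lieDeriv g + g * V.lieDeriv f := by
  simp only [lieDeriv_eq_mkDerivation, Derivation.leibniz, smul_eq_mul]

theorem PolyField.lieDeriv_C_mul (V : PolyField) (c : ℝ) (f : PlanePoly) :
    V.lieDeriv (C c * f) = C c * V.lieDeriv f := by
  simp [lieDeriv_mul]

theorem PolyField.lieDeriv_pow (V : PolyField) (f : PlanePoly) (n : ℕ) :
    V.lieDeriv (f ^ n) = (n : PlanePoly) * f ^ (n - 1) * V.lieDeriv f := by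
  simp only [lieDeriv_eq_mkDerivation, Derivation.leibniz_pow, smul_eq_mul, nsmul_eq_mul, mul_assoc]

/-- The chain rule: if the substitution `Φ` carries `V` to `W`, it intertwines their Lie
derivatives. -/
theorem PolyField.lieDeriv_bind₁ {V W Φ : PolyField}
    (h : ∀ i, V.lieDeriv (Φ i) = bind₁ Φ (W i)) (f : PlanePoly) :
    V.lieDeriv (bind₁ Φ f) = bind₁ Φ (W.lieDeriv f) := by
  induction f using MvPolynomial.induction_on with
  | C a => simp
  | add p q hp hq => simp only [map_add, lieDeriv_add, hp, hq]
  | mul_X p i hp => simp only [map_mul, lieDeriv_mul, map_add, hp, bind₁_X_right, h, lieDeriv_X]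

theorem IsQuasiHom.lieDeriv {t : Fin 2 → ℕ} {k r : ℤ} {f : PlanePoly} {V : PolyField}
    (hf : IsQuasiHom t k f) (hV : IsQuasiHomField t r V) : IsQuasiHom t (r + k) (V.lieDeriv f) := by
  refine IsWeightedHomogeneous.sum _ _ _ fun i _ => ?_
  have h1 : IsQuasiHom t (k - t i) (pderiv i f) :=
    IsWeightedHomogeneous.pderiv hf (sub_add_cancel _ _)
  have := h1.mul (hV i)
  rwa [show k - (t i : ℤ) + (r + t i) = r + k by ring] at this

theorem IsQuasiHom.bind₁ {t : Fin 2 → ℕ} {k : ℤ} {f : PlanePoly} {Φ : PolyField}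
    (hf : IsQuasiHom t k f) (hΦ : IsQuasiHomField t 0 Φ) :
    IsQuasiHom t k (MvPolynomial.bind₁ Φ f) := by
  induction hf using IsWeightedHomogeneous.induction_on with
  | zero => rw [map_zero]; exact isWeightedHomogeneous_zero _ _ _
  | add p q _ _ hp hq => rw [map_add]; exact hp.add hq
  | monomial d r h =>
    rw [bind₁_monomial]
    refine IsWeightedHomogeneous.C_mul ?_ r
    rw [← h, Finsupp.weight_apply]
    refine IsWeightedHomogeneous.prod _ _ _ fun i _ => ?_
    have := (hΦ i).pow (d i)
    rwa [zero_add] at this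

/-! ### Restriction to `x = 1` and the residue equation -/

/-- Restriction of a polynomial to the line `x = 1`. -/
noncomputable def dehom : PlanePoly →ₐ[ℝ] Polynomial ℝ := aeval ![1, Polynomial.X]

@[simp] theorem dehom_X_zero : dehom (X 0) = 1 := by simp [dehom]
@[simp] theorem dehom_X_one : dehom (X 1) = Polynomial.X := by simp [dehom]
@[simp] theorem dehom_C (c : ℝ) : dehom (C c) = Polynomial.C c := by
  simp [dehom, Polynomial.algebraMap_eq]

theorem eval_dehom (f : PlanePoly) (u : ℝ) : (dehom f).eval u = eval ![1, u] f := by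
  induction f using MvPolynomial.induction_on with
  | C a => simp
  | add p q hp hq => simp only [map_add, Polynomial.eval_add, hp, hq]
  | mul_X p i hp =>
    simp only [map_mul, Polynomial.eval_mul, hp]
    fin_cases i <;> simp

theorem derivative_dehom (f : PlanePoly) :
    Polynomial.derivative (dehom f) = dehom (pderiv 1 f) := by
  induction f using MvPolynomial.induction_on with
  | C a => simp
  | add p q hp hq => simp only [map_add, hp, hq]
  | mul_X p i hp =>
    simp only [map_mul, Polynomial.derivative_mul, hp, Derivation.leibniz, smul_eq_mul, map_add]
    fin_cases i <;> simp [pderiv_X]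
    ring

/-- Dilations carry the line `x = 1` onto the whole half-plane `x > 0`, which is Zariski dense. -/
theorem IsQuasiHom.eq_zero_of_dehom {t : Fin 2 → ℕ} (h0 : 0 < t 0) {k : ℤ} {f : PlanePoly}
    (hf : IsQuasiHom t k f) (h : dehom f = 0) : f = 0 := by
  refine MvPolynomial.funext_set ![Set.Ioi (0 : ℝ), Set.univ] (fun i => ?_) fun x hx => ?_
  · fin_cases i
    · exact Set.Ioi_infinite _
    · exact Set.infinite_univ
  · have hx0 : 0 < x 0 := by simpa using hx 0 (Set.mem_univ _)
    set ε := x 0 ^ (1 / (t 0 : ℝ)) with hε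
    have hεp : 0 < ε := Real.rpow_pos_of_pos hx0 _
    have hε0 : ε ^ t 0 = x 0 := by
      rw [hε, one_div, Real.rpow_inv_natCast_pow hx0.le h0.ne']
    have hxd : x = dilate t ε ![1, x 1 / ε ^ t 1] := by
      funext i
      fin_cases i
      · simp [dilate, hε0]
      · simp only [dilate, Fin.mk_one, Matrix.cons_val_one, Matrix.cons_val_fin_one]
        field_simp
    rw [hxd, hf.eval_dilate hεp.ne', ← eval_dehom, h]
    simp

/-- The equation satisfied on the line `x = 1` by a quasi-homogeneous first integral. -/
theorem IsQuasiHom.dehom_ode {t : Fin 2 → ℕ} {k : ℤ} {J : PlanePoly} {W : PolyField}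
    (hJ : IsQuasiHom t k J) (h : W.lieDeriv J = 0) :
    (Polynomial.C (t 1 : ℝ) * Polynomial.X * dehom (W 0) - Polynomial.C (t 0 : ℝ) * dehom (W 1)) *
      Polynomial.derivative (dehom J) = Polynomial.C (k : ℝ) * dehom (W 0) * dehom J := by
  have he := congrArg dehom hJ.euler
  rw [W.lieDeriv_eq] at h
  have hl := congrArg dehom h
  simp only [map_add, map_mul, dehom_C, dehom_X_zero, dehom_X_one, map_zero] at he hl
  rw [derivative_dehom]
  linear_combination dehom (W 0) * he - Polynomial.C (t 0 : ℝ) * hl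

/-- This compares residues at `z` in `j'/j = p / ((X - z) q)`: with `j = (X - z)^m g` and `g z ≠ 0`,
the left side has residue `m`. In the cleared form `q` may vanish at `z`, which is used for a double
zero of the coefficient of `j'`. -/
theorem rootMultiplicity_of_ode {K : Type*} [Field K] {j p q : Polynomial K} {z : K} (hj : j ≠ 0)
    (h : (Polynomial.X - Polynomial.C z) * q * Polynomial.derivative j = p * j) :
    (j.rootMultiplicity z : K) * q.eval z = p.eval z := by
  obtain ⟨g, hg, hdvd⟩ := Polynomial.exists_eq_pow_rootMultiplicity_mul_and_not_dvd j hj z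
  generalize j.rootMultiplicity z = m at hg ⊢
  have hgz : g.eval z ≠ 0 := fun h0 => hdvd (Polynomial.dvd_iff_isRoot.2 h0)
  have hne : (Polynomial.X - Polynomial.C z) ^ m ≠ 0 :=
    pow_ne_zero _ (Polynomial.X_sub_C_ne_zero z)
  have hd : (Polynomial.X - Polynomial.C z) * Polynomial.derivative j =
      (Polynomial.X - Polynomial.C z) ^ m *
        (Polynomial.C (m : K) * g + (Polynomial.X - Polynomial.C z) * Polynomial.derivative g) := by
    rw [hg, Polynomial.derivative_mul, Polynomial.derivative_X_sub_C_pow]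
    cases m with
    | zero => simp
    | succ m => simp only [Nat.add_sub_cancel, pow_succ]; ring
  have h2 : q * (Polynomial.C (m : K) * g +
      (Polynomial.X - Polynomial.C z) * Polynomial.derivative g) = p * g := by
    apply mul_left_cancel₀ hne
    rw [hg] at h hd
    linear_combination h - q * hd
  have h3 := congrArg (Polynomial.eval z) h2
  simp only [Polynomial.eval_mul, Polynomial.eval_add, Polynomial.eval_C, Polynomial.eval_sub,
    Polynomial.eval_X, sub_self, zero_mul, add_zero] at h3
  apply mul_right_cancel₀ hgz
  linear_combination h3

theorem eval_ne_zero_of_ode {K : Type*} [Field K] [CharZero K] {j p q : Polynomial K} {z : K}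
    (hj : j ≠ 0) (h : q * Polynomial.derivative j = p * j) (hq : q.eval z ≠ 0) :
    j.eval z ≠ 0 := by
  -- Multiplying both sides by `X - z` produces a zero residue, so the multiplicity of `z` is zero.
  have := rootMultiplicity_of_ode (z := z) (q := q) (p := (Polynomial.X - Polynomial.C z) * p) hj
    (by linear_combination (Polynomial.X - Polynomial.C z) * h)
  simp only [Polynomial.eval_mul, Polynomial.eval_sub, Polynomial.eval_X, Polynomial.eval_C,
    sub_self, zero_mul, mul_eq_zero, hq, or_false, Nat.cast_eq_zero,
    Polynomial.rootMultiplicity_eq_zero_iff] at this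
  exact fun h0 => hj (this h0)

/-- Quasi-homogeneous first integrals of the same degree are proportional. -/
theorem IsQuasiHom.exists_eq_C_mul {t : Fin 2 → ℕ} (h0 : 0 < t 0) {k : ℤ} {J₁ J₂ : PlanePoly}
    {W : PolyField} (hJ₁ : IsQuasiHom t k J₁) (hJ₂ : IsQuasiHom t k J₂)
    (h₁ : W.lieDeriv J₁ = 0) (h₂ : W.lieDeriv J₂ = 0) (hne : J₂ ≠ 0)
    (hq : Polynomial.C (t 1 : ℝ) * Polynomial.X * dehom (W 0) -
      Polynomial.C (t 0 : ℝ) * dehom (W 1) ≠ 0) :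
    ∃ c : ℝ, J₁ = C c * J₂ := by
  obtain ⟨u, hu⟩ : ∃ u : ℝ, (Polynomial.C (t 1 : ℝ) * Polynomial.X * dehom (W 0) -
      Polynomial.C (t 0 : ℝ) * dehom (W 1)).eval u ≠ 0 := by
    by_contra! hcon
    exact hq (Polynomial.funext fun u => by rw [hcon u, Polynomial.eval_zero])
  have hu₂ : (dehom J₂).eval u ≠ 0 :=
    eval_ne_zero_of_ode (fun h => hne (hJ₂.eq_zero_of_dehom h0 h)) (hJ₂.dehom_ode h₂) hu
  -- With this `c` the difference vanishes at `u`, a point where the coefficient of the derivative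
  -- is nonzero and hence no nonzero solution can vanish.
  set c := (dehom J₁).eval u / (dehom J₂).eval u with hc
  have hJ : IsQuasiHom t k (J₁ - C c * J₂) := IsWeightedHomogeneous.sub hJ₁ (hJ₂.C_mul c)
  have hL : W.lieDeriv (J₁ - C c * J₂) = 0 := by
    rw [W.lieDeriv_sub, W.lieDeriv_C_mul, h₁, h₂]; simp
  refine ⟨c, ?_⟩
  by_contra hcon
  refine eval_ne_zero_of_ode (fun h => hcon ?_) (hJ.dehom_ode hL) hu ?_
  · exact sub_eq_zero.1 (hJ.eq_zero_of_dehom h0 h)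
  · rw [map_sub, map_mul, dehom_C, Polynomial.eval_sub, Polynomial.eval_mul, Polynomial.eval_C, hc]
    field_simp
    ring

/-- Once the degree of `J` is `l * M`, both `J` and `I ^ l` are first integrals of one degree, hence
proportional. Only the arithmetic of the degrees remains to be checked for each normal form. -/
theorem isPrimitiveFirstIntegral_of_degree {t : Fin 2 → ℕ} (h0 : 0 < t 0) {M : ℤ} {I : PlanePoly}
    {W : PolyField} (hI : IsQuasiHom t M I) (hM : M ≠ 0) (hI0 : I ≠ 0) (hL : W.lieDeriv I = 0)
    (hq : Polynomial.C (t 1 : ℝ) * Polynomial.X * dehom (W 0) -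
      Polynomial.C (t 0 : ℝ) * dehom (W 1) ≠ 0)
    (hdeg : ∀ (k : ℤ) (J : PlanePoly), IsQuasiHom t k J → W.lieDeriv J = 0 → J ≠ 0 →
      ∃ l : ℕ, k = l * M) : IsPrimitiveFirstIntegral t W M I := by
  refine ⟨hI, ⟨fun c hc => ?_, hL⟩, fun k J hJ hJL => ?_⟩
  · rw [hc] at hI hI0
    exact hM (hI.inj_right hI0 (isWeightedHomogeneous_C _ c))
  · rcases eq_or_ne J 0 with rfl | hJ0
    · exact ⟨0, 0, by simp⟩
    · obtain ⟨l, rfl⟩ := hdeg k J hJ hJL hJ0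
      have hIl : IsQuasiHom t (l * M) (I ^ l) := by
        have := hI.pow l
        rwa [nsmul_eq_mul] at this
      obtain ⟨c, hc⟩ := hJ.exists_eq_C_mul h0 hIl hJL
        (by rw [W.lieDeriv_pow, hL, mul_zero]) (pow_ne_zero l hI0) hq
      exact ⟨c, l, hc⟩

theorem isQuasiHom_X (t : Fin 2 → ℕ) (i : Fin 2) : IsQuasiHom t (t i) (X i) :=
  isWeightedHomogeneous_X _ _ i

theorem IsQuasiHom.mul_pow_X {t : Fin 2 → ℕ} {k l : ℤ} {f : PlanePoly} (hf : IsQuasiHom t k f)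
    (i : Fin 2) (m : ℕ) (h : l = k + m * t i) : IsQuasiHom t l (f * X i ^ m) := by
  have := hf.mul ((isQuasiHom_X t i).pow m)
  rwa [nsmul_eq_mul, ← h] at this

theorem isQuasiHom_C_mul_pow_X {t : Fin 2 → ℕ} {l : ℤ} (c : ℝ) (i : Fin 2) (m : ℕ)
    (h : l = m * t i) : IsQuasiHom t l (C c * X i ^ m) :=
  IsQuasiHom.mul_pow_X (isWeightedHomogeneous_C _ c) i m (by rw [h, zero_add])

/-! ### Primitive first integrals of the normal forms -/

theorem isPrimitiveFirstIntegral_cusp (n : ℕ) :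
    IsPrimitiveFirstIntegral ![2, 2 * n + 1] ![X 1, X 0 ^ (2 * n)] (2 * (2 * n + 1))
      (2 * X 0 ^ (2 * n + 1) - C (2 * n + 1 : ℝ) * X 1 ^ 2) := by
  -- The curve `2 x^(2n+1) = (2n+1) y^2` meets `x = 1` at `y = ±z`. The residue at `z` reads `2
  -- (2n+1) z m = k z`, so the degree is `2 (2n+1)` times a multiplicity.
  set z : ℝ := √(2 / (2 * n + 1)) with hz
  have hn : (0 : ℝ) < 2 * n + 1 := by positivity
  have hz0 : 0 < z := Real.sqrt_pos.2 (by positivity)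
  have hz2 : (2 * n + 1) * z ^ 2 = 2 := by
    rw [hz, Real.sq_sqrt (by positivity)]
    field_simp
  have hq : Polynomial.C (((![2, 2 * n + 1] : Fin 2 → ℕ) 1 : ℕ) : ℝ) * Polynomial.X *
      dehom ((![X 1, X 0 ^ (2 * n)] : PolyField) 0) -
      Polynomial.C (((![2, 2 * n + 1] : Fin 2 → ℕ) 0 : ℕ) : ℝ) *
      dehom ((![X 1, X 0 ^ (2 * n)] : PolyField) 1) =
      (Polynomial.X - Polynomial.C z) *
        (Polynomial.C (2 * n + 1 : ℝ) * (Polynomial.X + Polynomial.C z)) := by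
    have := congrArg Polynomial.C hz2
    simp only [Polynomial.C_mul, Polynomial.C_pow] at this
    simp only [Matrix.cons_val_one, Matrix.cons_val_fin_one, Matrix.cons_val_zero, dehom_X_one,
      map_pow, dehom_X_zero, one_pow, Nat.cast_add, Nat.cast_mul, Nat.cast_ofNat, Nat.cast_one]
    linear_combination this
  refine isPrimitiveFirstIntegral_of_degree (by simp) ?_ (by positivity) ?_ ?_ ?_ ?_
  · refine IsWeightedHomogeneous.sub ?_ ?_
    · have : (2 : PlanePoly) = C 2 := (map_ofNat C 2).symm
      rw [this]
      exact isQuasiHom_C_mul_pow_X _ _ _ (by simp; ring)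
    · exact isQuasiHom_C_mul_pow_X _ _ _ (by simp)
  · intro h
    have := congrArg (eval ![1, 0]) h
    simp at this
  · have h2 : (2 : PlanePoly) = C 2 := (map_ofNat C 2).symm
    simp only [h2, PolyField.lieDeriv_sub, PolyField.lieDeriv_C_mul, PolyField.lieDeriv_pow,
      PolyField.lieDeriv_X, Matrix.cons_val_one, Matrix.cons_val_fin_one, Matrix.cons_val_zero,
      Nat.add_sub_cancel]
    simp [← h2]
    ring
  · rw [hq]
    exact mul_ne_zero (Polynomial.X_sub_C_ne_zero z)
      (mul_ne_zero (Polynomial.C_ne_zero.2 hn.ne') (Polynomial.X_add_C_ne_zero z))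
  · intro k J hJ hL hJ0
    have h := hJ.dehom_ode hL
    rw [hq] at h
    have hm := rootMultiplicity_of_ode (fun h0 => hJ0 (hJ.eq_zero_of_dehom (by simp) h0)) h
    refine ⟨(dehom J).rootMultiplicity z, ?_⟩
    generalize (dehom J).rootMultiplicity z = m at hm ⊢
    simp at hm
    have : (k : ℝ) = m * (2 * (2 * n + 1)) := by
      apply mul_right_cancel₀ hz0.ne'
      linear_combination -hm
    exact_mod_cast this

/-- The normal form `(y, s (n + 1) x ^ (2 n + 1)) + d x ^ n (x, (n + 1) y)`. -/
noncomputable def nodeField (n : ℕ) (s d : ℝ) : PolyField :=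
  ![X 1 + C d * X 0 ^ n * X 0,
    C (s * (n + 1)) * X 0 ^ (2 * n + 1) + C d * X 0 ^ n * (C (n + 1 : ℝ) * X 1)]

section nodeField

variable {n : ℕ} {s d : ℝ} {k : ℤ} {J : PlanePoly}

theorem nodeField_ode_coeff (n : ℕ) (s d : ℝ) :
    Polynomial.C (((![1, n + 1] : Fin 2 → ℕ) 1 : ℕ) : ℝ) * Polynomial.X *
      dehom (nodeField n s d 0) -
      Polynomial.C (((![1, n + 1] : Fin 2 → ℕ) 0 : ℕ) : ℝ) * dehom (nodeField n s d 1) =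
      Polynomial.C (n + 1 : ℝ) * (Polynomial.X ^ 2 - Polynomial.C s) := by
  simp [nodeField]
  ring

theorem nodeField_ode (hJ : IsQuasiHom ![1, n + 1] k J) (hL : (nodeField n s d).lieDeriv J = 0) :
    Polynomial.C (n + 1 : ℝ) * (Polynomial.X ^ 2 - Polynomial.C s) *
      Polynomial.derivative (dehom J) =
      Polynomial.C (k : ℝ) * (Polynomial.X + Polynomial.C d) * dehom J := by
  have h := hJ.dehom_ode hL
  rw [nodeField_ode_coeff] at h
  rw [h]
  simp [nodeField]

theorem dehom_ne_zero (hJ : IsQuasiHom ![1, n + 1] k J) (hJ0 : J ≠ 0) : dehom J ≠ 0 :=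
  fun h0 => hJ0 (hJ.eq_zero_of_dehom (by simp) h0)

/-- Here the coefficient `(n+1) X^2` has a double zero at `0`; one factor `X` stays in `q`, so the
left side of the residue identity vanishes. -/
theorem degree_mul_eq_zero_of_nodeField_zero (hJ : IsQuasiHom ![1, n + 1] k J) (hJ0 : J ≠ 0)
    (hL : (nodeField n 0 d).lieDeriv J = 0) : (k : ℝ) * d = 0 := by
  have h := rootMultiplicity_of_ode (z := 0) (q := Polynomial.C (n + 1 : ℝ) * Polynomial.X)
    (p := Polynomial.C (k : ℝ) * (Polynomial.X + Polynomial.C d)) (dehom_ne_zero hJ hJ0) (by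
      rw [← nodeField_ode hJ hL]
      simp only [map_zero, sub_zero]
      ring)
  simpa [eq_comm] using h

/-- The zeros `±i` of `X^2 + 1` are not real, so the residue is taken over `ℂ`: `2 (n+1) m i = k (i
+ d)`. Its real and imaginary parts are the two claims. -/
theorem degree_of_nodeField_neg_one (hJ : IsQuasiHom ![1, n + 1] k J) (hJ0 : J ≠ 0)
    (hL : (nodeField n (-1) d).lieDeriv J = 0) :
    (k : ℝ) * d = 0 ∧ ∃ m : ℕ, k = m * (2 * (n + 1)) := by
  have hode := congrArg (Polynomial.map Complex.ofRealHom) (nodeField_ode hJ hL)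
  have hI : (Polynomial.C Complex.I ^ 2 : Polynomial ℂ) = -1 := by
    rw [← Polynomial.C_pow, Complex.I_sq]; simp
  have h := rootMultiplicity_of_ode (z := Complex.I)
    (j := (dehom J).map Complex.ofRealHom)
    (q := Polynomial.C (n + 1 : ℂ) * (Polynomial.X + Polynomial.C Complex.I))
    (p := Polynomial.C (k : ℂ) * (Polynomial.X + Polynomial.C (d : ℂ)))
    ((Polynomial.map_ne_zero_iff Complex.ofRealHom.injective).2 (dehom_ne_zero hJ hJ0)) (by
      simp [← Polynomial.derivative_map] at hode ⊢
      rw [← hode]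
      linear_combination -(Polynomial.derivative
        (Polynomial.map Complex.ofRealHom (dehom J))) * (n + 1 : Polynomial ℂ) * hI)
  generalize ((dehom J).map Complex.ofRealHom).rootMultiplicity Complex.I = m at h
  have hre := congrArg Complex.re h
  have him := congrArg Complex.im h
  simp at hre him
  refine ⟨by simpa [eq_comm] using hre, m, ?_⟩
  have : (k : ℝ) = m * (2 * (n + 1)) := by linear_combination -him
  exact_mod_cast this

/-- The numbers `a` and `b` are the multiplicities of `1` and `-1`, the points where the curves `y =
±x^(n+1)` meet `x = 1`. -/
theorem multiplicities_of_nodeField_one (hJ : IsQuasiHom ![1, n + 1] k J) (hJ0 : J ≠ 0)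
    (hL : (nodeField n 1 d).lieDeriv J = 0) :
    ∃ a b : ℕ, 2 * a * (n + 1) = k * (1 + d) ∧ 2 * b * (n + 1) = k * (1 - d) := by
  have h₁ := rootMultiplicity_of_ode (z := 1)
    (q := Polynomial.C (n + 1 : ℝ) * (Polynomial.X + 1))
    (p := Polynomial.C (k : ℝ) * (Polynomial.X + Polynomial.C d)) (dehom_ne_zero hJ hJ0) (by
      rw [← nodeField_ode hJ hL]
      simp only [Polynomial.C_1]
      ring)
  have h₂ := rootMultiplicity_of_ode (z := -1)
    (q := Polynomial.C (n + 1 : ℝ) * (Polynomial.X - 1))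
    (p := Polynomial.C (k : ℝ) * (Polynomial.X + Polynomial.C d)) (dehom_ne_zero hJ hJ0) (by
      rw [← nodeField_ode hJ hL]
      simp only [Polynomial.C_1, Polynomial.C_neg]
      ring)
  refine ⟨(dehom J).rootMultiplicity 1, (dehom J).rootMultiplicity (-1), ?_, ?_⟩
  · simp only [Polynomial.eval_mul, Polynomial.eval_add, Polynomial.eval_C, Polynomial.eval_X,
      Polynomial.eval_one] at h₁
    linear_combination h₁
  · simp only [Polynomial.eval_mul, Polynomial.eval_add, Polynomial.eval_C, Polynomial.eval_X,
      Polynomial.eval_one, Polynomial.eval_sub] at h₂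
    linear_combination -h₂

theorem nodeField_zero_right (n : ℕ) (s : ℝ) :
    nodeField n s 0 = ![X 1, C (s * (n + 1)) * X 0 ^ (2 * n + 1)] := by
  simp [nodeField]

theorem nodeField_ode_coeff_ne_zero (n : ℕ) (s d : ℝ) :
    Polynomial.C (((![1, n + 1] : Fin 2 → ℕ) 1 : ℕ) : ℝ) * Polynomial.X *
      dehom (nodeField n s d 0) -
      Polynomial.C (((![1, n + 1] : Fin 2 → ℕ) 0 : ℕ) : ℝ) * dehom (nodeField n s d 1) ≠ 0 := by
  rw [nodeField_ode_coeff]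
  refine mul_ne_zero ?_ (Polynomial.X_pow_sub_C_ne_zero two_pos s)
  rw [Ne, Polynomial.C_eq_zero]
  positivity

theorem isPrimitiveFirstIntegral_nodeField_zero (n : ℕ) {s : ℝ} (hs : s = 1 ∨ s = -1) :
    IsPrimitiveFirstIntegral ![1, n + 1] (nodeField n s 0) (2 * (n + 1))
      (-C s * X 0 ^ (2 * n + 2) + X 1 ^ 2) := by
  refine isPrimitiveFirstIntegral_of_degree (by simp) ?_ (by positivity) ?_ ?_
    (nodeField_ode_coeff_ne_zero n s 0) ?_
  · refine IsWeightedHomogeneous.add ?_ ?_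
    · rw [← C_neg]
      exact isQuasiHom_C_mul_pow_X _ _ _ (by simp; ring)
    · have := isQuasiHom_C_mul_pow_X (t := ![1, n + 1]) (l := 2 * (n + 1)) 1 1 2 (by simp)
      rwa [C_1, one_mul] at this
  · intro h
    have := congrArg (eval ![0, 1]) h
    simp at this
  · rw [nodeField_zero_right, ← C_neg]
    simp only [PolyField.lieDeriv_add, PolyField.lieDeriv_C_mul, PolyField.lieDeriv_pow,
      PolyField.lieDeriv_X, Matrix.cons_val_one, Matrix.cons_val_fin_one, Matrix.cons_val_zero]
    simp
    ring
  · intro k J hJ hL hJ0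
    rcases hs with rfl | rfl
    · obtain ⟨a, -, ha, -⟩ := multiplicities_of_nodeField_one hJ hJ0 hL
      refine ⟨a, ?_⟩
      have : (k : ℝ) = a * (2 * (n + 1)) := by linear_combination -ha
      exact_mod_cast this
    · exact (degree_of_nodeField_neg_one hJ hJ0 hL).2

theorem isPrimitiveFirstIntegral_nodeField_one (n : ℕ) {m₁ m₂ : ℕ} (h₁ : 0 < m₁)
    (hco : Nat.Coprime m₁ m₂) (hd : d = ((m₁ : ℝ) - m₂) / ((m₁ : ℝ) + m₂)) :
    IsPrimitiveFirstIntegral ![1, n + 1] (nodeField n 1 d) ((n + 1) * (m₁ + m₂))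
      ((X 1 - X 0 ^ (n + 1)) ^ m₁ * (X 1 + X 0 ^ (n + 1)) ^ m₂) := by
  have hm : (0 : ℝ) < m₁ + m₂ := by positivity
  have hd' : d * (m₁ + m₂) = m₁ - m₂ := by rw [hd]; field_simp
  refine isPrimitiveFirstIntegral_of_degree (by simp) ?_ (by positivity) ?_ ?_
    (nodeField_ode_coeff_ne_zero n 1 d) ?_
  · have hx : IsQuasiHom ![1, n + 1] (n + 1) (X 0 ^ (n + 1)) := by
      have := isQuasiHom_C_mul_pow_X (t := ![1, n + 1]) (l := n + 1) 1 0 (n + 1) (by simp)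
      rwa [C_1, one_mul] at this
    have hy : IsQuasiHom ![1, n + 1] (n + 1) (X 1) := by
      have := isQuasiHom_X ![1, n + 1] 1
      simpa using this
    have h := ((hy.sub hx).pow m₁).mul ((hy.add hx).pow m₂)
    simp only [nsmul_eq_mul] at h
    rwa [show (m₁ : ℤ) * ((n : ℤ) + 1) + m₂ * ((n : ℤ) + 1) = (n + 1) * (m₁ + m₂) by ring] at h
  · intro h
    have := congrArg (eval ![0, 1]) h
    simp at this
  -- Darboux's method: both curves are invariant, with cofactors `(n+1)(d - 1) x^n` and `(n+1)(d +
  -- 1) x^n`; weighted by `m₁` and `m₂` these cancel.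
  · have hA : (nodeField n 1 d).lieDeriv (X 1 - X 0 ^ (n + 1)) =
        C ((n + 1) * (d - 1)) * X 0 ^ n * (X 1 - X 0 ^ (n + 1)) := by
      simp only [PolyField.lieDeriv_sub, PolyField.lieDeriv_pow, PolyField.lieDeriv_X]
      simp [nodeField]
      ring
    have hB : (nodeField n 1 d).lieDeriv (X 1 + X 0 ^ (n + 1)) =
        C ((n + 1) * (d + 1)) * X 0 ^ n * (X 1 + X 0 ^ (n + 1)) := by
      simp only [PolyField.lieDeriv_add, PolyField.lieDeriv_pow, PolyField.lieDeriv_X]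
      simp [nodeField]
      ring
    have hpow : ∀ (c : ℝ) (f : PlanePoly) (m : ℕ),
        (nodeField n 1 d).lieDeriv f = C c * X 0 ^ n * f →
        (nodeField n 1 d).lieDeriv (f ^ m) = C (m * c) * X 0 ^ n * f ^ m := by
      intro c f m hf
      rw [PolyField.lieDeriv_pow, hf]
      cases m with
      | zero => simp
      | succ m => simp [pow_succ]; ring
    rw [PolyField.lieDeriv_mul, hpow _ _ m₁ hA, hpow _ _ m₂ hB]
    have hz : (m₁ : ℝ) * ((n + 1) * (d - 1)) + m₂ * ((n + 1) * (d + 1)) = 0 := by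
      linear_combination (n + 1 : ℝ) * hd'
    have hC := congrArg (C : ℝ → PlanePoly) hz
    rw [C_add, C_0] at hC
    linear_combination X 0 ^ n * ((X 1 - X 0 ^ (n + 1)) ^ m₁ * (X 1 + X 0 ^ (n + 1)) ^ m₂) * hC
  · intro k J hJ hL hJ0
    obtain ⟨a, b, ha, hb⟩ := multiplicities_of_nodeField_one hJ hJ0 hL
    have hn : (0 : ℝ) < n + 1 := by positivity
    have ha' : (a : ℝ) * (m₁ + m₂) * (n + 1) = k * m₁ := by
      linear_combination (m₁ + m₂) / 2 * ha + k / 2 * hd'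
    have hb' : (b : ℝ) * (m₁ + m₂) * (n + 1) = k * m₂ := by
      linear_combination (m₁ + m₂) / 2 * hb - k / 2 * hd'
    have hab : a * m₂ = b * m₁ := by
      have : (a : ℝ) * m₂ = b * m₁ := by
        apply mul_right_cancel₀ (mul_pos hm hn).ne'
        linear_combination m₂ * ha' - m₁ * hb'
      exact_mod_cast this
    -- The multiplicities are in the ratio `m₁ : m₂`, so coprimality makes `a` a multiple `m₁ * l`;
    -- this `l` is the exponent of the power.
    obtain ⟨l, rfl⟩ : m₁ ∣ a := hco.dvd_of_dvd_mul_right ⟨b, by rw [hab, mul_comm]⟩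
    refine ⟨l, ?_⟩
    have hm₁ : (m₁ : ℝ) ≠ 0 := by positivity
    have : (k : ℝ) = l * ((n + 1) * (m₁ + m₂)) := by
      apply mul_right_cancel₀ hm₁
      push_cast at ha'
      linear_combination -ha'
    exact_mod_cast this

end nodeField

/-! ### Dilation limits and the linear part -/

theorem tendsto_dilate {t : Fin 2 → ℕ} (ht : ∀ i, 0 < t i) (p : Plane) :
    Tendsto (fun ε => dilate t ε p) (𝓝[>] 0) (𝓝 0) := by
  have hc : Continuous fun ε => dilate t ε p := by
    unfold dilate
    fun_prop
  have h := hc.tendsto 0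
  have h0 : dilate t 0 p = 0 := by
    funext i
    simp [dilate, (ht i).ne']
  rw [h0] at h
  exact h.mono_left nhdsWithin_le_nhds

theorem dilate_ne_zero (t : Fin 2 → ℕ) {ε : ℝ} (hε : ε ≠ 0) {p : Plane} (hp : p ≠ 0) :
    dilate t ε p ≠ 0 := by
  obtain ⟨i, hi⟩ := Function.ne_iff.1 hp
  exact Function.ne_iff.2 ⟨i, mul_ne_zero (pow_ne_zero _ hε) hi⟩

/-- A quasi-homogeneous field with an isolated zero at the origin vanishes nowhere else. -/
theorem IsIsolatedSingularity.ne_zero {t : Fin 2 → ℕ} (ht : ∀ i, 0 < t i) {r : ℤ} {W : PolyField}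
    (hW : IsQuasiHomField t r W) (h : IsIsolatedSingularity W.toMap) {p : Plane} (hp : p ≠ 0) :
    W.toMap p ≠ 0 := by
  intro h0
  have hev := eventually_nhdsWithin_iff.1 h.2
  -- A zero away from the origin would propagate along its dilation orbit, which accumulates at the
  -- origin.
  obtain ⟨ε, h1, h2⟩ := (((tendsto_dilate ht p).eventually hev).and self_mem_nhdsWithin).exists
  have hε : ε ≠ 0 := (Set.mem_Ioi.1 h2).ne'
  refine h1 (dilate_ne_zero t hε hp) (funext fun i => ?_)
  have hi : eval p (W i) = 0 := congrFun h0 i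
  simp [PolyField.toMap, (hW i).eval_dilate hε, hi]

/-- Along a dilation orbit the rescaled component is a power series in `ε` with coefficients `eval p
(V k i)`. Convergence at one `δ > 0` dominates all smaller `ε`, so the limit can be taken termwise.
-/
theorem HasQuasiHomExpansion.tendsto_leading {t : Fin 2 → ℕ} (ht : ∀ i, 0 < t i) {r : ℤ}
    {F : Plane → Plane} {V : ℕ → PolyField} (h : HasQuasiHomExpansion t r F V) (p : Plane)
    (i : Fin 2) :
    Tendsto (fun ε : ℝ => ε ^ (-(r + t i)) * F (dilate t ε p) i) (𝓝[>] 0)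
      (𝓝 (eval p (V 0 i))) := by
  have hev := ((tendsto_dilate ht p).eventually h.hasSum).and self_mem_nhdsWithin
  have hterm : ∀ ε : ℝ, 0 < ε →
      HasSum (fun k => (V k).toMap (dilate t ε p)) (F (dilate t ε p)) →
      HasSum (fun k => ε ^ k * eval p (V k i)) (ε ^ (-(r + t i)) * F (dilate t ε p) i) := by
    intro ε hε hs
    have h1 := (Pi.hasSum.1 hs i).mul_left (ε ^ (-(r + t i)))
    have he : (fun k => ε ^ k * eval p (V k i)) =
        fun k => ε ^ (-(r + t i)) * (V k).toMap (dilate t ε p) i := by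
      funext k
      change _ = _ * eval _ (V k i)
      rw [(h.quasiHom k i).eval_dilate hε.ne', ← mul_assoc, ← zpow_add₀ hε.ne', ← zpow_natCast]
      congr 2
      ring
    rw [he]
    exact h1
  obtain ⟨δ, hδ, hδ0⟩ := hev.exists
  have hlim : Tendsto (fun ε : ℝ => ∑' k, ε ^ k * eval p (V k i)) (𝓝[>] 0)
      (𝓝 (∑' k, (0 : ℝ) ^ k * eval p (V k i))) := by
    refine tendsto_tsum_of_dominated_convergence (bound := fun k => ‖δ ^ k * eval p (V k i)‖)
      (hterm δ hδ0 hδ).summable.norm (fun k => ?_) ?_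
    · have hc : Continuous fun ε : ℝ => ε ^ k * eval p (V k i) := by fun_prop
      exact (hc.tendsto 0).mono_left nhdsWithin_le_nhds
    · filter_upwards [Ioo_mem_nhdsGT hδ0] with ε hε k
      rw [norm_mul, norm_mul, norm_pow, norm_pow]
      gcongr
      rw [Real.norm_of_nonneg hε.1.le, Real.norm_of_nonneg hδ0.le]
      exact hε.2.le
  rw [tsum_eq_single 0 (fun k hk => by simp [hk]), pow_zero, one_mul] at hlim
  refine hlim.congr' ?_
  filter_upwards [hev] with ε hε
  exact (hterm ε hε.2 hε.1).tsum_eq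

/-- Where the dilation acts as the scalar `ε ^ m` (on an axis, or everywhere for weights `(1, 1)`),
the quotient is a difference quotient of `F` at the origin. -/
theorem tendsto_linear_part {t : Fin 2 → ℕ} {F : Plane → Plane} {A : Plane →L[ℝ] Plane}
    (hF : HasFDerivAt F A 0) (hF0 : F 0 = 0) {p : Plane} {m : ℕ} (hm : 0 < m)
    (hp : ∀ ε, dilate t ε p = ε ^ m • p) (i : Fin 2) :
    Tendsto (fun ε : ℝ => (ε ^ m)⁻¹ * F (dilate t ε p) i) (𝓝[>] 0) (𝓝 (A p i)) := by
  have h1 : HasDerivAt (fun τ : ℝ => F (τ • p)) (A p) 0 := by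
    have hl : HasDerivAt (fun τ : ℝ => τ • p) p 0 := by
      simpa using (hasDerivAt_id (0 : ℝ)).smul_const p
    exact HasFDerivAt.comp_hasDerivAt (0 : ℝ) (by simpa using hF) hl
  have h2 := (hasDerivAt_iff_tendsto_slope_zero.1 (hasDerivAt_pi.1 h1 i))
  have h3 : Tendsto (fun ε : ℝ => ε ^ m) (𝓝[>] 0) (𝓝[≠] 0) := by
    refine tendsto_nhdsWithin_iff.2 ⟨?_, ?_⟩
    · have := ((continuous_pow m : Continuous fun ε : ℝ => ε ^ m).tendsto 0)
      rw [zero_pow hm.ne'] at this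
      exact this.mono_left nhdsWithin_le_nhds
    · filter_upwards [self_mem_nhdsWithin] with ε hε
      exact pow_ne_zero _ (Set.mem_Ioi.1 hε).ne'
  refine (h2.comp h3).congr fun ε => ?_
  simp [hp, hF0]

section LinearPart

variable {t : Fin 2 → ℕ} {r : ℤ} {F : Plane → Plane} {V : ℕ → PolyField}

/-- The component is of order `ε ^ (r + t i)` on the orbit, hence negligible against `ε ^ m`. -/
theorem HasQuasiHomExpansion.fderiv_eq_zero (ht : ∀ i, 0 < t i)
    (h : HasQuasiHomExpansion t r F V) (hF0 : F 0 = 0) {p : Plane} {m : ℕ} (hm : 0 < m)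
    (hp : ∀ ε, dilate t ε p = ε ^ m • p) {i : Fin 2} (hlt : (m : ℤ) < r + t i) :
    fderiv ℝ F 0 p i = 0 := by
  have h1 := tendsto_linear_part h.analyticAt.differentiableAt.hasFDerivAt hF0 hm hp i
  obtain ⟨l, hl⟩ := Int.eq_ofNat_of_zero_le (sub_nonneg.2 hlt.le)
  have hl0 : l ≠ 0 := by rintro rfl; simp at hl; omega
  have h2 : Tendsto (fun ε : ℝ => ε ^ l) (𝓝[>] 0) (𝓝 0) := by
    have := ((continuous_pow l : Continuous fun ε : ℝ => ε ^ l).tendsto 0)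
    rw [zero_pow hl0] at this
    exact this.mono_left nhdsWithin_le_nhds
  have h3 := h2.mul (h.tendsto_leading ht p i)
  rw [zero_mul] at h3
  refine tendsto_nhds_unique h1 (h3.congr' ?_)
  filter_upwards [self_mem_nhdsWithin] with ε hε
  have hε : ε ≠ 0 := (Set.mem_Ioi.1 hε).ne'
  rw [← mul_assoc, ← zpow_natCast, ← zpow_natCast, ← zpow_neg, ← zpow_add₀ hε]
  congr 2
  omega

theorem HasQuasiHomExpansion.fderiv_eq_eval (ht : ∀ i, 0 < t i)
    (h : HasQuasiHomExpansion t r F V) (hF0 : F 0 = 0) {p : Plane} {m : ℕ} (hm : 0 < m)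
    (hp : ∀ ε, dilate t ε p = ε ^ m • p) {i : Fin 2} (heq : (m : ℤ) = r + t i) :
    fderiv ℝ F 0 p i = eval p (V 0 i) := by
  have h1 := tendsto_linear_part h.analyticAt.differentiableAt.hasFDerivAt hF0 hm hp i
  refine tendsto_nhds_unique h1 ((h.tendsto_leading ht p i).congr fun ε => ?_)
  rw [← heq, zpow_neg, zpow_natCast]

theorem dilate_single (t : Fin 2 → ℕ) (j : Fin 2) (ε : ℝ) :
    dilate t ε (Pi.single j 1) = ε ^ t j • (Pi.single j 1 : Plane) := by
  funext i
  rcases eq_or_ne i j with rfl | hij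
  · simp [dilate]
  · simp [dilate, Pi.single_eq_of_ne hij]

/-- Only a pure power of the `j`-th variable survives on its axis, and `γ` is its exponent. -/
theorem IsQuasiHom.degree_of_eval_single {k : ℤ} {f : PlanePoly} (hf : IsQuasiHom t k f)
    (hf0 : eval 0 f = 0) {j : Fin 2} (h : eval (Pi.single j 1) f ≠ 0) :
    ∃ γ : ℕ, 0 < γ ∧ k = γ * t j := by
  rw [eval_eq'] at h
  obtain ⟨m, hm, hne⟩ := Finset.exists_ne_zero_of_sum_ne_zero h
  have hz : ∀ i, i ≠ j → m i = 0 := fun i hij => by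
    by_contra hmi
    refine hne (mul_eq_zero_of_right _ (Finset.prod_eq_zero (Finset.mem_univ i) ?_))
    rw [Pi.single_eq_of_ne hij, zero_pow hmi]
  refine ⟨m j, Nat.pos_of_ne_zero fun hmj => ?_, ?_⟩
  · have hm0 : m = 0 := Finsupp.ext fun i => by
      rcases eq_or_ne i j with rfl | hij
      · exact hmj
      · exact hz i hij
    subst hm0
    refine mem_support_iff.1 hm ?_
    rw [← constantCoeff_eq, ← hf0, eval_zero]
  · rw [← hf (mem_support_iff.1 hm), weight_eq]
    fin_cases j
    · have := hz 1 (by simp)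
      simp [this, mul_comm]
    · have := hz 0 (by simp)
      simp [this, mul_comm]

theorem exists_ne_zero_of_isNilpotent {A : Plane →L[ℝ] Plane} (hA : IsNilpotent A) :
    ∃ p ≠ 0, A p = 0 := by
  by_contra! hcon
  obtain ⟨k, hk⟩ := hA
  have : ∀ k : ℕ, (A ^ k) (Pi.single 0 1) ≠ 0 := by
    intro k
    induction k with
    | zero => simp
    | succ k ih =>
      rw [pow_succ']
      exact hcon _ ih
  exact this k (by rw [hk]; rfl)

theorem clm_apply_eq (A : Plane →L[ℝ] Plane) (p : Plane) (i : Fin 2) :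
    A p i = p 0 * A (Pi.single 0 1) i + p 1 * A (Pi.single 1 1) i := by
  have hp : p = p 0 • (Pi.single 0 1 : Plane) + p 1 • (Pi.single 1 1 : Plane) := by
    funext i
    fin_cases i <;> simp
  conv_lhs => rw [hp]
  simp

/-- The matrix is triangular, so the diagonal of a power consists of powers of the diagonal entries.
-/
theorem diagonal_eq_zero_of_isNilpotent {A : Plane →L[ℝ] Plane} (hA : IsNilpotent A)
    (h : A (Pi.single 0 1) 1 = 0) : A (Pi.single 0 1) 0 = 0 ∧ A (Pi.single 1 1) 1 = 0 := by
  obtain ⟨k, hk⟩ := hA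
  have h1 : ∀ k : ℕ, (A ^ k) (Pi.single 0 1) 1 = 0 ∧
      (A ^ k) (Pi.single 0 1) 0 = A (Pi.single 0 1) 0 ^ k ∧
      (A ^ k) (Pi.single 1 1) 1 = A (Pi.single 1 1) 1 ^ k := by
    intro k
    induction k with
    | zero => simp
    | succ k ih =>
      rw [pow_succ']
      simp only [mul_apply_eq_comp]
      refine ⟨?_, ?_, ?_⟩ <;> rw [clm_apply_eq] <;> simp [ih, h, pow_succ]
  obtain ⟨-, h2, h3⟩ := h1 k
  rw [hk] at h2 h3
  exact ⟨eq_zero_of_pow_eq_zero h2.symm, eq_zero_of_pow_eq_zero h3.symm⟩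

/-- The type and degree of a nilpotent field whose leading part has an isolated zero. -/
theorem HasQuasiHomExpansion.degree_eq (ht : ∀ i, 0 < t i) (hcop : Nat.Coprime (t 0) (t 1))
    (hle : t 0 ≤ t 1) (h : HasQuasiHomExpansion t r F V) (hnil : IsNilpotentSingularity F)
    (hiso : IsIsolatedSingularity (V 0).toMap) :
    t 0 < t 1 ∧ r = t 1 - t 0 := by
  obtain ⟨hF0, hA0, hA⟩ := hnil
  have hq : IsQuasiHomField t r (V 0) := by simpa using h.quasiHom 0
  have hne : ∀ p : Plane, p ≠ 0 → (V 0).toMap p ≠ 0 := fun p hp => hiso.ne_zero ht hq hp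
  have hz : ∀ i, eval 0 (V 0 i) = 0 := fun i => congrFun hiso.1 i
  have ht0 := ht 0
  have ht1 := ht 1
  have hsingle : ∀ j : Fin 2, ∃ i, eval (Pi.single j 1) (V 0 i) ≠ 0 := fun j =>
    Function.ne_iff.1 (hne (Pi.single j 1) (by simp))
  have hr : 0 ≤ r := by
    obtain ⟨i, hi⟩ := hsingle 1
    obtain ⟨γ, hγ, hk⟩ := (hq i).degree_of_eval_single (hz i) hi
    have h1 : (t i : ℤ) ≤ t 1 := by fin_cases i <;> simp [hle]
    have h2 : (t 1 : ℤ) ≤ γ * t 1 := le_mul_of_one_le_left (by positivity) (by exact_mod_cast hγ)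
    linarith
  rcases hle.eq_or_lt with heq | hlt
  -- Coprime equal weights are `(1, 1)`. If `r = 0`, then `V 0` is the linear part, which has a
  -- kernel; if `r > 0`, the linear part vanishes.
  · exfalso
    have h01 : ∀ i, t i = 1 := by
      rw [← heq, Nat.coprime_self] at hcop
      intro i
      fin_cases i
      · exact hcop
      · exact heq ▸ hcop
    have hd : ∀ (p : Plane) ε, dilate t ε p = ε ^ 1 • p := fun p ε => by
      funext i
      simp [dilate, h01]
    rcases hr.eq_or_lt with hr0 | hr0
    · obtain ⟨p, hp, hAp⟩ := exists_ne_zero_of_isNilpotent hA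
      refine hne p hp (funext fun i => ?_)
      rw [PolyField.toMap, ← h.fderiv_eq_eval ht hF0 one_pos (hd p) (by simp [← hr0, h01]), hAp]
    · refine hA0 (ContinuousLinearMap.ext fun p => funext fun i => ?_)
      rw [h.fderiv_eq_zero ht hF0 one_pos (hd p) (by simp [hr0, h01])]
      rfl
  · have h10 : fderiv ℝ F 0 (Pi.single 0 1) 1 = 0 :=
      h.fderiv_eq_zero ht hF0 ht0 (dilate_single t 0) (by omega)
    obtain ⟨h00, h11⟩ := diagonal_eq_zero_of_isNilpotent hA h10
    have hA01 : fderiv ℝ F 0 (Pi.single 1 1) 0 ≠ 0 := fun h01 => by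
      refine hA0 (ContinuousLinearMap.ext fun p => funext fun i => ?_)
      rw [clm_apply_eq]
      fin_cases i <;> simp [*]
    have hr1 : r + t 0 ≤ t 1 := by
      by_contra! hcon
      exact hA01 (h.fderiv_eq_zero ht hF0 ht1 (dilate_single t 1) hcon)
    -- If `r + t 0 < t 1`, the first component of `V 0` has too small a degree to contain a power of
    -- `y`. The second could contain only `y` itself, whose coefficient is a diagonal entry of the
    -- nilpotent linear part; so `V 0` would vanish at `(0, 1)`.
    have hr2 : r = t 1 - t 0 := by
      rcases hr1.eq_or_lt with h1 | h1
      · omega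
      exfalso
      obtain ⟨i, hi⟩ := hsingle 1
      obtain ⟨γ, hγ, hk⟩ := (hq i).degree_of_eval_single (hz i) hi
      fin_cases i
      · have h2 : (t 1 : ℤ) ≤ γ * t 1 :=
          le_mul_of_one_le_left (by positivity) (by exact_mod_cast hγ)
        simp only [Fin.zero_eta] at hk
        omega
      · simp only [Fin.mk_one] at hk hi
        have hγ1 : γ = 1 := by
          by_contra hγ1
          have h2 : (2 : ℤ) * t 1 ≤ γ * t 1 :=
            mul_le_mul_of_nonneg_right (by omega) (by positivity)
          omega
        subst hγ1
        rw [← h.fderiv_eq_eval ht hF0 ht1 (dilate_single t 1) (by simpa using hk.symm)] at hi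
        exact hi h11
    exact ⟨hlt, hr2⟩

end LinearPart

/-! ### The leading form of an analytic first integral -/

theorem hasFDerivAt_eval (f : PlanePoly) (x : Plane) :
    HasFDerivAt (fun y : Plane => eval y f)
      (∑ i, eval x (pderiv i f) • (ContinuousLinearMap.proj i : Plane →L[ℝ] ℝ)) x := by
  induction f using MvPolynomial.induction_on with
  | C a => simpa using hasFDerivAt_const a x
  | add p q hp hq =>
    simp only [map_add, add_smul, Finset.sum_add_distrib]
    exact hp.add hq
  | mul_X p j hp =>
    have h := hp.mul (hasFDerivAt_apply (𝕜 := ℝ) j x)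
    have he : (fun y : Plane => eval y (p * X j)) = fun y => eval y p * y j :=
      funext fun y => by rw [map_mul, eval_X]
    rw [he]
    refine h.congr_fderiv ?_
    simp only [Derivation.leibniz, smul_eq_mul, map_add, map_mul, eval_X, add_smul,
      Finset.sum_add_distrib, Finset.smul_sum, smul_smul]
    congr 1
    rw [Finset.sum_eq_single j]
    · simp [pderiv_X]
    · intro i _ hij
      rw [pderiv_X_of_ne hij.symm]
      simp
    · simp

theorem fderiv_eval_single (f : PlanePoly) (x : Plane) (i : Fin 2) :
    fderiv ℝ (fun y : Plane => eval y f) x (Pi.single i 1) = eval x (pderiv i f) := by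
  rw [(hasFDerivAt_eval f x).fderiv]
  fin_cases i <;> simp

theorem exists_eval_eq_diagonal {n : ℕ} (q : ContinuousMultilinearMap ℝ (fun _ : Fin n => Plane) ℝ) :
    ∃ P : PlanePoly, P.IsHomogeneous n ∧ ∀ x, eval x P = q fun _ => x := by
  refine ⟨∑ s : Fin n → Fin 2, C (q fun k => Pi.single (s k) 1) * ∏ k, X (s k), ?_, fun x => ?_⟩
  · refine IsHomogeneous.sum _ _ _ fun s _ => ?_
    have h := IsHomogeneous.prod (R := ℝ) Finset.univ (fun k => X (s k)) (fun _ => 1)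
      fun k _ => isHomogeneous_X ℝ (s k)
    simp only [Finset.sum_const, Finset.card_univ, Fintype.card_fin, smul_eq_mul, mul_one] at h
    exact h.C_mul _
  · have hx : x = ∑ j, x j • (Pi.single j 1 : Plane) := by
      funext i
      fin_cases i <;> simp
    conv_rhs => rw [hx]
    rw [q.map_sum, map_sum]
    refine Finset.sum_congr rfl fun s _ => ?_
    rw [q.map_smul_univ (fun k => x (s k)) fun k => Pi.single (s k) 1]
    simp [mul_comm, map_prod]

/-- The formal multilinear series `p` with its first `N` terms removed. -/
noncomputable def dropTerms (p : FormalMultilinearSeries ℝ Plane ℝ) (N : ℕ) :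
    FormalMultilinearSeries ℝ Plane ℝ := fun n => if n < N then 0 else p n

theorem HasFPowerSeriesAt.sub_partialSum {I : Plane → ℝ} {p : FormalMultilinearSeries ℝ Plane ℝ}
    (h : HasFPowerSeriesAt I p 0) (N : ℕ) :
    HasFPowerSeriesAt (fun x => I x - p.partialSum N x) (dropTerms p N) 0 := by
  obtain ⟨R, hR⟩ := h
  refine ⟨R, hR.r_le.trans (FormalMultilinearSeries.radius_le_of_le fun n => ?_), hR.r_pos,
    fun {y} hy => ?_⟩
  · rw [dropTerms]
    split_ifs <;> simp
  · have h1 := hR.hasSum hy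
    have h2 : HasSum (fun n => if n < N then p n (fun _ => y) else 0) (p.partialSum N y) := by
      have h3 : p.partialSum N y =
          ∑ n ∈ Finset.range N, if n < N then p n (fun _ => y) else 0 :=
        Finset.sum_congr rfl fun n hn => (if_pos (Finset.mem_range.1 hn)).symm
      rw [h3]
      exact hasSum_sum_of_ne_finset_zero fun n hn => if_neg (by simpa using hn)
    have h3 := h1.sub h2
    rw [zero_add] at h3 ⊢
    have he : (fun n => dropTerms p N n fun _ => y) =
        fun n => p n (fun _ => y) - if n < N then p n (fun _ => y) else 0 := by
      funext n
      rw [dropTerms]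
      split_ifs <;> simp
    rw [he]
    exact h3

/-- The last clause controls the gradient of the remainder, because a first integral enters only
through its gradient. It follows from the power series of the derivative, whose terms below order
`N` come from the removed terms. -/
theorem exists_taylor {I : Plane → ℝ} (hI : AnalyticAt ℝ I 0) :
    ∃ P : ℕ → PlanePoly, (∀ n, (P n).IsHomogeneous n) ∧
      (∀ᶠ x in 𝓝 0, HasSum (fun n => eval x (P n)) (I x)) ∧
      ∀ N, (fun x => fderiv ℝ (fun y => I y - eval y (∑ n ∈ Finset.range (N + 1), P n)) x)
        =O[𝓝 0] fun x => ‖x‖ ^ N := by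
  obtain ⟨p, hp⟩ := hI
  choose P hhom hP using fun n => exists_eval_eq_diagonal (p n)
  refine ⟨P, hhom, ?_, fun N => ?_⟩
  · filter_upwards [hp.eventually_hasSum] with x hx
    simpa [hP] using hx
  · obtain ⟨R, hR⟩ := hp.sub_partialSum (N + 1)
    have h := hR.fderiv.hasFPowerSeriesAt.isBigO_sub_partialSum_pow N
    have h0 : ∀ y, FormalMultilinearSeries.partialSum (FormalMultilinearSeries.derivSeries
        (dropTerms p (N + 1))) N y = 0 := fun y => by
      refine Finset.sum_eq_zero fun n hn => ?_
      rw [FormalMultilinearSeries.derivSeries_eq_zero]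
      · rfl
      · rw [dropTerms, if_pos (by simpa using hn)]
    simp only [h0, sub_zero, zero_add] at h
    simpa only [map_sum, hP, FormalMultilinearSeries.partialSum] using h

theorem tendsto_eval_dilate_of_lt_weight {t : Fin 2 → ℕ} {K : ℤ} {f : PlanePoly}
    (hf : ∀ m ∈ f.support, K < Finsupp.weight (fun i => (t i : ℤ)) m) (p : Plane) :
    Tendsto (fun ε : ℝ => ε ^ (-K) * eval (dilate t ε p) f) (𝓝[>] 0) (𝓝 0) := by
  simp_rw [eval_eq', Finset.mul_sum]
  have h0 : (0 : ℝ) = ∑ _m ∈ f.support, 0 := Finset.sum_const_zero.symm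
  conv_rhs => rw [h0]
  refine tendsto_finsetSum _ fun m hm => ?_
  obtain ⟨l, hl⟩ := Int.eq_ofNat_of_zero_le (sub_nonneg.2 (hf m hm).le)
  have hlt := hf m hm
  have hl0 : l ≠ 0 := by rintro rfl; simp at hl; omega
  have h1 : Continuous fun ε : ℝ => ε ^ l * (coeff m f * ∏ i, p i ^ m i) := by fun_prop
  have h2 := h1.tendsto 0
  rw [zero_pow hl0, zero_mul] at h2
  refine (h2.mono_left nhdsWithin_le_nhds).congr' ?_
  filter_upwards [self_mem_nhdsWithin] with ε hε
  have hε : ε ≠ 0 := (Set.mem_Ioi.1 hε).ne'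
  have h3 : ε ^ l = ε ^ (-K) * ε ^ (Finsupp.weight (fun i => (t i : ℤ)) m) := by
    rw [← zpow_natCast, ← zpow_add₀ hε]
    congr 1
    have : (l : ℤ) = Finsupp.weight (fun i => (t i : ℤ)) m - K := hl.symm
    omega
  rw [prod_dilate t hε, h3]
  ring

theorem norm_dilate_le {t : Fin 2 → ℕ} (ht : ∀ i, 0 < t i) {ε : ℝ} (h0 : 0 ≤ ε) (h1 : ε ≤ 1)
    (p : Plane) : ‖dilate t ε p‖ ≤ ε * ‖p‖ := by
  refine (pi_norm_le_iff_of_nonneg (by positivity)).2 fun i => ?_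
  rw [dilate, norm_mul, norm_pow, Real.norm_of_nonneg h0]
  gcongr
  · exact pow_le_of_le_one h0 h1 (ht i).ne'
  · exact norm_le_pi_norm p i

/-- The leading quasi-homogeneous form of a nonconstant analytic function, with the asymptotics of
the partial derivatives along dilations. -/
theorem exists_leadingForm {t : Fin 2 → ℕ} (ht : ∀ i, 0 < t i) {I : Plane → ℝ}
    (hI : AnalyticAt ℝ I 0) (hne : ¬ ∀ᶠ p in 𝓝 (0 : Plane), I p = I 0) :
    ∃ (M : ℕ) (J : PlanePoly), 0 < M ∧ J ≠ 0 ∧ IsQuasiHom t M J ∧ ∀ (p : Plane) (i : Fin 2),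
      Tendsto (fun ε : ℝ => ε ^ ((t i : ℤ) - M) * fderiv ℝ I (dilate t ε p) (Pi.single i 1))
        (𝓝[>] 0) (𝓝 (eval p (pderiv i J))) := by
  obtain ⟨P, hhom, hsum, hrem⟩ := exists_taylor hI
  -- The number `M` will be the least weight of a nonconstant monomial in the Taylor series.
  have hex : ∃ M : ℕ, ∃ m : Fin 2 →₀ ℕ, m ≠ 0 ∧ coeff m (P m.degree) ≠ 0 ∧
      t 0 * m 0 + t 1 * m 1 = M := by
    by_contra! hcon
    have hP : ∀ n, n ≠ 0 → P n = 0 := fun n hn => by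
      ext m
      rw [coeff_zero]
      by_contra hm
      have hd : m.degree = n := by
        by_contra hd
        exact hm ((hhom n).coeff_eq_zero hd)
      subst hd
      exact hcon _ m (by rintro rfl; simp at hn) hm rfl
    have hval : ∀ x, HasSum (fun n => eval x (P n)) (eval x (P 0)) := fun x =>
      hasSum_single 0 fun n hn => by rw [hP n hn, map_zero]
    have hconst : ∀ᶠ x in 𝓝 (0 : Plane), I x = coeff 0 (P 0) := by
      filter_upwards [hsum] with x hx
      rw [hx.unique (hval x), (totalDegree_eq_zero_iff_eq_C.1
        ((totalDegree_zero_iff_isHomogeneous _).2 (hhom 0)))]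
      simp
    refine hne ?_
    rw [hconst.self_of_nhds]
    exact hconst
  classical
  obtain ⟨m₀, hm₀, hc₀, hM₀⟩ := Nat.find_spec hex
  have hmin : ∀ m : Fin 2 →₀ ℕ, m ≠ 0 → coeff m (P m.degree) ≠ 0 →
      Nat.find hex ≤ t 0 * m 0 + t 1 * m 1 := fun m hm hc => Nat.find_min' hex ⟨m, hm, hc, rfl⟩
  generalize Nat.find hex = M at hM₀ hmin
  have hdeg : ∀ m : Fin 2 →₀ ℕ, m.degree = m 0 + m 1 := fun m => by
    rw [Finsupp.degree_eq_sum, Fin.sum_univ_two]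
  have hdegle : m₀.degree ≤ M := by
    rw [hdeg, ← hM₀]
    exact add_le_add (Nat.le_mul_of_pos_left _ (ht 0)) (Nat.le_mul_of_pos_left _ (ht 1))
  set w : Fin 2 → ℤ := fun i => (t i : ℤ) with hw
  -- Weights are at least `1`, so every monomial of weight at most `M` has total degree at most `M`
  -- and is seen by this truncation.
  set T : PlanePoly := ∑ n ∈ Finset.range (M + 1), P n with hT
  have hcT : ∀ m : Fin 2 →₀ ℕ, coeff m T = if m.degree ≤ M then coeff m (P m.degree) else 0 := by
    intro m
    rw [hT, coeff_sum]
    split_ifs with h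
    · refine Finset.sum_eq_single_of_mem _ (by simpa [Nat.lt_succ_iff] using h) fun n _ hn => ?_
      exact (hhom n).coeff_eq_zero hn.symm
    · refine Finset.sum_eq_zero fun n hn => (hhom n).coeff_eq_zero ?_
      rintro rfl
      exact h (by simpa [Nat.lt_succ_iff] using hn)
  set J : PlanePoly := weightedHomogeneousComponent w (M : ℤ) T with hJ
  have hcJ : ∀ m, coeff m J = if Finsupp.weight w m = M then coeff m T else 0 := fun m => by
    rw [hJ, coeff_weightedHomogeneousComponent]
  refine ⟨M, J, ?_, ?_, weightedHomogeneousComponent_isWeightedHomogeneous _ _, fun p i => ?_⟩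
  · refine lt_of_lt_of_le (Nat.pos_of_ne_zero fun h => hm₀ ?_) hdegle
    exact (Finsupp.degree_eq_zero_iff m₀).1 h
  · refine ne_of_apply_ne (coeff m₀) ?_
    rw [coeff_zero, hcJ, if_pos (by rw [hw, weight_eq]; exact_mod_cast hM₀), hcT, if_pos hdegle]
    exact hc₀
  -- The constant term is exempt; differentiation removes it.
  have hhigh : ∀ m, m ≠ 0 → coeff m (T - J) ≠ 0 → (M : ℤ) < Finsupp.weight w m := by
    intro m hm hc
    rw [coeff_sub, hcJ] at hc
    split_ifs at hc with h
    · simp at hc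
    · rw [sub_zero, hcT] at hc
      split_ifs at hc with h'
      · refine lt_of_le_of_ne ?_ (Ne.symm h)
        rw [hw, weight_eq]
        exact_mod_cast hmin m hm hc
      · exact absurd rfl hc
  have h1 : Tendsto (fun ε : ℝ => ε ^ (-((M : ℤ) - t i)) * eval (dilate t ε p) (pderiv i (T - J)))
      (𝓝[>] 0) (𝓝 0) := by
    refine tendsto_eval_dilate_of_lt_weight (fun m hm => ?_) p
    have hc : coeff (m + Finsupp.single i 1) (T - J) ≠ 0 := by
      rw [mem_support_iff, coeff_pderiv] at hm
      exact left_ne_zero_of_mul hm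
    have := hhigh _ (by
      intro h0
      have := DFunLike.congr_fun h0 i
      simp at this) hc
    rw [map_add, Finsupp.weight_single] at this
    simp only [one_smul, hw] at this ⊢
    omega
  have h2 : ∀ ε : ℝ, 0 < ε →
      ε ^ (-((M : ℤ) - t i)) * eval (dilate t ε p) (pderiv i J) = eval p (pderiv i J) := by
    intro ε hε
    have hq : IsQuasiHom t ((M : ℤ) - t i) (pderiv i J) :=
      IsWeightedHomogeneous.pderiv (weightedHomogeneousComponent_isWeightedHomogeneous _ _)
        (sub_add_cancel _ _)
    rw [hq.eval_dilate hε.ne', ← mul_assoc, ← zpow_add₀ hε.ne', neg_add_cancel, zpow_zero, one_mul]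
  have h3 : Tendsto (fun ε : ℝ => ε ^ (-((M : ℤ) - t i)) *
      fderiv ℝ (fun y => I y - eval y T) (dilate t ε p) (Pi.single i 1)) (𝓝[>] 0) (𝓝 0) := by
    obtain ⟨c, hc⟩ := (hrem M).bound
    -- The gradient of the remainder is `O(ε ^ M)`, which leaves a factor `ε ^ t i` after rescaling.
    have hb : Tendsto (fun ε : ℝ => ε ^ t i * (|c| * ‖p‖ ^ M)) (𝓝[>] 0) (𝓝 0) := by
      have hcont : Continuous fun ε : ℝ => ε ^ t i * (|c| * ‖p‖ ^ M) := by fun_prop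
      have := hcont.tendsto 0
      rw [zero_pow (ht i).ne', zero_mul] at this
      exact this.mono_left nhdsWithin_le_nhds
    refine squeeze_zero_norm' ?_ hb
    filter_upwards [(tendsto_dilate ht p).eventually hc, Ioo_mem_nhdsGT one_pos] with ε hε hε1
    have hsingle : ‖(Pi.single i 1 : Plane)‖ ≤ 1 := by
      rw [Pi.norm_single, norm_one]
    have hn : ‖fderiv ℝ (fun y => I y - eval y T) (dilate t ε p) (Pi.single i 1)‖ ≤
        |c| * (ε * ‖p‖) ^ M := by
      refine (ContinuousLinearMap.le_opNorm _ _).trans ?_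
      refine (mul_le_of_le_one_right (norm_nonneg _) hsingle).trans (hε.trans ?_)
      rw [norm_pow, norm_norm]
      gcongr
      · exact le_abs_self c
      · exact norm_dilate_le ht hε1.1.le hε1.2.le p
    rw [norm_mul, norm_zpow, Real.norm_of_nonneg hε1.1.le]
    refine (mul_le_mul_of_nonneg_left hn (zpow_nonneg hε1.1.le _)).trans_eq ?_
    have hε0 := hε1.1.ne'
    rw [neg_sub, zpow_sub₀ hε0, zpow_natCast, zpow_natCast, mul_pow]
    field_simp
  have h4 := (h3.add h1).add (tendsto_const_nhds (x := eval p (pderiv i J)))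
  rw [add_zero, zero_add] at h4
  refine h4.congr' ?_
  filter_upwards [(tendsto_dilate ht p).eventually hI.eventually_analyticAt,
    self_mem_nhdsWithin] with ε hε hε0
  have hsub := fderiv_fun_sub hε.differentiableAt (hasFDerivAt_eval T (dilate t ε p)).differentiableAt
  rw [hsub, ← h2 ε hε0, sub_apply, fderiv_eval_single, map_sub, map_sub, neg_sub]
  ring

/-- The leading part of an analytically integrable field has a quasi-homogeneous first integral of
positive degree. -/
theorem IsAnalyticallyIntegrable.exists_quasiHom {t : Fin 2 → ℕ} (ht : ∀ i, 0 < t i) {r : ℤ}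
    {F : Plane → Plane} {V : ℕ → PolyField} (h : HasQuasiHomExpansion t r F V)
    (hint : IsAnalyticallyIntegrable F) :
    ∃ (M : ℕ) (J : PlanePoly), 0 < M ∧ J ≠ 0 ∧ IsQuasiHom t M J ∧ (V 0).lieDeriv J = 0 := by
  obtain ⟨I, hI, hne, hIF⟩ := hint
  obtain ⟨M, J, hM, hJ0, hJ, hlim⟩ := exists_leadingForm ht hI hne
  refine ⟨M, J, hM, hJ0, hJ, MvPolynomial.funext fun p => ?_⟩
  rw [PolyField.lieDeriv_eq, map_add, map_mul, map_mul, map_zero]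
  -- This is the limit of `ε ^ (-(r + M))` times the derivative of `I` along `F`, which is zero near
  -- the origin.
  have h1 := ((hlim p 0).mul (h.tendsto_leading ht p 0)).add
    ((hlim p 1).mul (h.tendsto_leading ht p 1))
  refine tendsto_nhds_unique h1 (tendsto_const_nhds.congr' ?_)
  filter_upwards [(tendsto_dilate ht p).eventually hIF, self_mem_nhdsWithin] with ε hε hε0
  have hε0 : ε ≠ 0 := (Set.mem_Ioi.1 hε0).ne'
  have hp : ∀ x : Plane, x = x 0 • (Pi.single 0 1 : Plane) + x 1 • (Pi.single 1 1 : Plane) := by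
    intro x
    funext i
    fin_cases i <;> simp
  rw [hp (F _), map_add, map_smul, map_smul, smul_eq_mul, smul_eq_mul] at hε
  have h2 : ∀ i : Fin 2, ε ^ (-(r + t i)) = ε ^ (-(r + M)) * (ε ^ ((t i : ℤ) - M))⁻¹ := fun i => by
    rw [← zpow_neg, ← zpow_add₀ hε0]
    congr 1
    ring
  have h3 : ∀ k : ℤ, ε ^ k * (ε ^ k)⁻¹ = 1 := fun k => mul_inv_cancel₀ (zpow_ne_zero k hε0)
  rw [h2, h2]
  linear_combination (-ε ^ (-(r + M))) * hε -
    ε ^ (-(r + M)) * F (dilate t ε p) 0 * fderiv ℝ I (dilate t ε p) (Pi.single 0 1) *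
      h3 ((t 0 : ℤ) - M) -
    ε ^ (-(r + M)) * F (dilate t ε p) 1 * fderiv ℝ I (dilate t ε p) (Pi.single 1 1) *
      h3 ((t 1 : ℤ) - M)

/-! ### Quasi-homogeneous changes of variables -/

theorem eval_bind₁_toMap (Φ : PolyField) (f : PlanePoly) (p : Plane) :
    eval p (bind₁ Φ f) = eval (Φ.toMap p) f := by
  change (eval p) (bind₁ Φ f) = eval (fun i => eval p (Φ i)) f
  rw [← coe_aeval_eq_eval, RingHom.coe_coe, aeval_bind₁]
  rfl

theorem bind₁_bind₁_of_inverse {Φ Ψ : PolyField} (h : ∀ i, bind₁ Φ (Ψ i) = X i) (f : PlanePoly) :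
    bind₁ Φ (bind₁ Ψ f) = f := by
  rw [bind₁_bind₁]
  simp only [h]
  exact aeval_X_left_apply f

theorem toMap_zero_of_isQuasiHomField {t : Fin 2 → ℕ} (ht : ∀ i, 0 < t i) {Ψ : PolyField}
    (hΨ : IsQuasiHomField t 0 Ψ) : Ψ.toMap 0 = 0 := by
  funext i
  change eval 0 (Ψ i) = 0
  rw [eval_zero, constantCoeff_eq]
  by_contra h
  have h1 := hΨ i h
  have h2 := ht i
  simp at h1
  omega

theorem analyticAt_eval (f : PlanePoly) (p : Plane) :
    AnalyticAt ℝ (fun q : Plane => eval q f) p := by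
  have h := AnalyticAt.aeval_mvPolynomial (𝕜 := ℝ) (f := fun q : Plane => q) (z := p)
    (fun i => (ContinuousLinearMap.proj (R := ℝ) (φ := fun _ : Fin 2 => ℝ) i).analyticAt p) f
  simpa [coe_aeval_eq_eval] using h

theorem analyticAt_toMap (Ψ : PolyField) (p : Plane) : AnalyticAt ℝ Ψ.toMap p :=
  analyticAt_pi_iff.2 fun i => analyticAt_eval (Ψ i) p

/-- The transform of a quasi-homogeneous expansion by a quasi-homogeneous change of variables of
degree zero with polynomial inverse. -/
theorem HasQuasiHomExpansion.pushforward {t : Fin 2 → ℕ} (ht : ∀ i, 0 < t i) {r : ℤ}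
    {F : Plane → Plane} {V : ℕ → PolyField} (h : HasQuasiHomExpansion t r F V) {Φ Ψ : PolyField}
    (hΦ : IsQuasiHomField t 0 Φ) (hΨ : IsQuasiHomField t 0 Ψ) (hinv : ∀ i, bind₁ Φ (Ψ i) = X i) :
    ∃ G : Plane → Plane, IsPushforward Φ F G ∧
      HasQuasiHomExpansion t r G fun k i => bind₁ Ψ ((V k).lieDeriv (Φ i)) := by
  have hΨ0 := toMap_zero_of_isQuasiHomField ht hΨ
  have hinv' : ∀ p, Ψ.toMap (Φ.toMap p) = p := fun p => funext fun i => by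
    change eval (Φ.toMap p) (Ψ i) = p i
    rw [← eval_bind₁_toMap, hinv, eval_X]
  have hΨa := analyticAt_toMap Ψ 0
  have hG : ∀ (p v : Plane) (i : Fin 2),
      (Φ.jacobian p).mulVec v i = ∑ j, eval p (pderiv j (Φ i)) * v j := fun p v i => rfl
  refine ⟨fun q => (Φ.jacobian (Ψ.toMap q)).mulVec (F (Ψ.toMap q)), ?_, ?_, fun k i => ?_, ?_⟩
  · exact Eventually.of_forall fun p => by simp only [hinv']
  · refine analyticAt_pi_iff.2 fun i => ?_
    simp only [hG]
    refine Finset.analyticAt_fun_sum _ fun j _ => ?_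
    refine AnalyticAt.mul ?_ ?_
    · exact AnalyticAt.comp (g := fun q : Plane => eval q (pderiv j (Φ i)))
        (analyticAt_eval (pderiv j (Φ i)) (Ψ.toMap 0)) hΨa
    · refine analyticAt_pi_iff.1 (AnalyticAt.comp (g := F) ?_ hΨa) j
      rw [hΨ0]
      exact h.analyticAt
  · refine IsQuasiHom.bind₁ ?_ hΨ
    have := (hΦ i).lieDeriv (h.quasiHom k)
    rwa [zero_add] at this
  · have htend : Tendsto Ψ.toMap (𝓝 0) (𝓝 0) := by
      have := hΨa.continuousAt.tendsto
      rwa [hΨ0] at this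
    filter_upwards [htend.eventually h.hasSum] with q hq
    refine Pi.hasSum.2 fun i => ?_
    have h1 : ∀ k, PolyField.toMap (fun i => bind₁ Ψ ((V k).lieDeriv (Φ i))) q i =
        ∑ j, eval (Ψ.toMap q) (pderiv j (Φ i)) * (V k).toMap (Ψ.toMap q) j := fun k => by
      change eval q (bind₁ Ψ ((V k).lieDeriv (Φ i))) = _
      rw [eval_bind₁_toMap, PolyField.lieDeriv, map_sum]
      simp only [map_mul]
      rfl
    simp only [h1, hG]
    exact hasSum_sum fun j _ => (Pi.hasSum.1 hq j).mul_left _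

section Transfer

variable {t : Fin 2 → ℕ} {V N Φ Ψ : PolyField}

theorem lieDeriv_transfer (hN : ∀ i, V.lieDeriv (Φ i) = bind₁ Φ (N i))
    (hΦΨ : ∀ i, bind₁ Φ (Ψ i) = X i) (hΨΦ : ∀ i, bind₁ Ψ (Φ i) = X i) (f : PlanePoly) :
    N.lieDeriv (bind₁ Ψ f) = bind₁ Ψ (V.lieDeriv f) := by
  have h := PolyField.lieDeriv_bind₁ hN (bind₁ Ψ f)
  rw [bind₁_bind₁_of_inverse hΦΨ] at h
  rw [h, bind₁_bind₁_of_inverse hΨΦ]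

theorem toMap_ne_zero_transfer (hN : ∀ i, V.lieDeriv (Φ i) = bind₁ Φ (N i))
    (hΦΨ : ∀ i, bind₁ Φ (Ψ i) = X i) (hΨΦ : ∀ i, bind₁ Ψ (Φ i) = X i)
    (hΦ0 : Φ.toMap 0 = 0) (hV : ∀ p, p ≠ 0 → V.toMap p ≠ 0) (q : Plane) (hq : q ≠ 0) :
    N.toMap q ≠ 0 := by
  intro h0
  have hinv : Φ.toMap (Ψ.toMap q) = q := funext fun i => by
    change eval (Ψ.toMap q) (Φ i) = q i
    rw [← eval_bind₁_toMap, hΨΦ, eval_X]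
  refine hV (Ψ.toMap q) (fun h => hq ?_) (funext fun i => ?_)
  · rw [← hinv, h, hΦ0]
  · change eval (Ψ.toMap q) (V i) = 0
    have h1 := lieDeriv_transfer hN hΦΨ hΨΦ (X i)
    rw [PolyField.lieDeriv_X] at h1
    rw [← eval_bind₁_toMap, ← h1, PolyField.lieDeriv, map_sum]
    refine Finset.sum_eq_zero fun j _ => ?_
    have hj : eval q (N j) = 0 := congrFun h0 j
    rw [map_mul, hj, mul_zero]

end Transfer

/-- The map `(x, y) ↦ (α x, β y + γ x ^ m)`. -/
noncomputable def shear (α β γ : ℝ) (m : ℕ) : PolyField :=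
  ![C α * X 0, C β * X 1 + C γ * X 0 ^ m]

theorem isQuasiHomField_shear {t : Fin 2 → ℕ} (α β : ℝ) {γ : ℝ} {m : ℕ}
    (h : γ = 0 ∨ t 1 = m * t 0) : IsQuasiHomField t 0 (shear α β γ m) := by
  intro i
  rw [zero_add]
  fin_cases i
  · have := isQuasiHom_C_mul_pow_X (t := t) (l := t 0) α 0 1 (by simp)
    simpa [shear] using this
  · have h1 := isQuasiHom_C_mul_pow_X (t := t) (l := t 1) β 1 1 (by simp)
    rw [pow_one] at h1
    refine IsWeightedHomogeneous.add h1 ?_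
    rcases h with rfl | h
    · rw [C_0, zero_mul]
      exact isWeightedHomogeneous_zero _ _ _
    · exact isQuasiHom_C_mul_pow_X _ _ _ (by simp only [Fin.mk_one]; exact_mod_cast h)

theorem shear_comp {α β γ : ℝ} (hα : α ≠ 0) (hβ : β ≠ 0) (m : ℕ) (i : Fin 2) :
    bind₁ (shear α β γ m) (shear α⁻¹ β⁻¹ (-(β⁻¹ * γ * α⁻¹ ^ m)) m i) = X i := by
  refine MvPolynomial.funext fun p => ?_
  fin_cases i
  · simp [shear, hα]
  · simp [shear, mul_pow]
    field_simp
    simp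

theorem shear_comp' {α β γ : ℝ} (hα : α ≠ 0) (hβ : β ≠ 0) (m : ℕ) (i : Fin 2) :
    bind₁ (shear α⁻¹ β⁻¹ (-(β⁻¹ * γ * α⁻¹ ^ m)) m) (shear α β γ m i) = X i := by
  refine MvPolynomial.funext fun p => ?_
  fin_cases i
  · simp [shear, hα]
  · simp [shear, mul_pow]
    field_simp
    simp

theorem det_jacobian_shear {α β : ℝ} (hα : α ≠ 0) (hβ : β ≠ 0) (γ : ℝ) (m : ℕ) (p : Plane) :
    ((shear α β γ m).jacobian p).det ≠ 0 := by
  rw [Matrix.det_fin_two]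
  simp [PolyField.jacobian, shear, pderiv_X, hα, hβ]

/-! ### Normalisation of the leading part -/

/-- A quasi-homogeneous polynomial is a combination of the monomials of its degree. -/
theorem IsQuasiHom.eq_sum {t : Fin 2 → ℕ} {k : ℤ} {f : PlanePoly} (hf : IsQuasiHom t k f)
    (S : Finset (ℕ × ℕ)) (hS : ∀ a b : ℕ, (t 0 : ℤ) * a + t 1 * b = k → (a, b) ∈ S) :
    ∃ c : ℕ × ℕ → ℝ, f = ∑ s ∈ S, C (c s) * (X 0 ^ s.1 * X 1 ^ s.2) := by
  have hmon : ∀ s : ℕ × ℕ, (X 0 ^ s.1 * X 1 ^ s.2 : PlanePoly) =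
      monomial (Finsupp.single 0 s.1 + Finsupp.single 1 s.2) 1 := fun s => by
    rw [X_pow_eq_monomial, X_pow_eq_monomial, monomial_mul, one_mul]
  have hm : ∀ (m : Fin 2 →₀ ℕ) (s : ℕ × ℕ),
      Finsupp.single 0 s.1 + Finsupp.single 1 s.2 = m ↔ s = (m 0, m 1) := fun m s => by
    constructor
    · rintro rfl
      simp
    · rintro rfl
      ext i
      fin_cases i <;> simp
  refine ⟨fun s => coeff (Finsupp.single 0 s.1 + Finsupp.single 1 s.2) f, ?_⟩
  ext m
  simp only [coeff_sum, coeff_C_mul, hmon, coeff_monomial, hm, mul_ite, mul_one, mul_zero,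
    Finset.sum_ite_eq']
  rw [(hm m (m 0, m 1)).2 rfl]
  split_ifs with h
  · rfl
  · by_contra hc
    refine h (hS _ _ ?_)
    rw [← weight_eq, hf hc]

theorem exists_pow_odd_eq (k : ℕ) (x : ℝ) : ∃ y : ℝ, y ^ (2 * k + 1) = x := by
  have h : ∀ z : ℝ, 0 ≤ z → ∃ y : ℝ, y ^ (2 * k + 1) = z := fun z hz =>
    ⟨z ^ ((2 * k + 1 : ℕ) : ℝ)⁻¹, Real.rpow_inv_natCast_pow hz (by omega)⟩
  rcases le_total 0 x with hx | hx
  · exact h x hx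
  · obtain ⟨y, hy⟩ := h (-x) (by linarith)
    exact ⟨-y, by rw [Odd.neg_pow ⟨k, rfl⟩, hy, neg_neg]⟩

/-- Every real number is `s α ^ n` with `α > 0` and `s` equal to `0`, `1` or `-1`. -/
theorem exists_sign_mul_pow {n : ℕ} (hn : n ≠ 0) (x : ℝ) :
    ∃ s α : ℝ, 0 < α ∧ (s = 0 ∨ s = 1 ∨ s = -1) ∧ x = s * α ^ n := by
  have h : ∀ z : ℝ, 0 < z → ∃ α : ℝ, 0 < α ∧ α ^ n = z := fun z hz =>
    ⟨z ^ (n : ℝ)⁻¹, Real.rpow_pos_of_pos hz _, Real.rpow_inv_natCast_pow hz.le hn⟩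
  rcases lt_trichotomy x 0 with hx | rfl | hx
  · obtain ⟨α, hα, h1⟩ := h (-x) (by linarith)
    exact ⟨-1, α, hα, by simp, by rw [h1]; ring⟩
  · exact ⟨0, 1, one_pos, by simp, by simp⟩
  · obtain ⟨α, hα, h1⟩ := h x hx
    exact ⟨1, α, hα, by simp, by rw [h1]; ring⟩

section LeadingPart

variable {n : ℕ} {f : PlanePoly}

theorem IsQuasiHom.eq_of_node_fst (hf : IsQuasiHom ![1, n + 1] (n + 1) f) :
    ∃ b a : ℝ, f = C b * X 1 + C a * X 0 ^ (n + 1) := by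
  obtain ⟨c, hc⟩ := hf.eq_sum {(0, 1), (n + 1, 0)} fun a b h => by
    simp only [Matrix.cons_val_zero, Matrix.cons_val_one, Matrix.cons_val_fin_one] at h
    have hb : b < 2 := by
      by_contra! hb
      have : (2 : ℤ) * (n + 1) ≤ (n + 1 : ℤ) * b := by nlinarith
      push_cast at h
      omega
    simp only [Finset.mem_insert, Finset.mem_singleton, Prod.mk.injEq]
    interval_cases b <;> push_cast at h <;> omega
  refine ⟨c (0, 1), c (n + 1, 0), ?_⟩
  rw [hc, Finset.sum_pair (by simp)]
  simp

theorem IsQuasiHom.eq_of_node_snd (hf : IsQuasiHom ![1, n + 1] (2 * n + 1) f) :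
    ∃ c e : ℝ, f = C c * X 0 ^ (2 * n + 1) + C e * (X 0 ^ n * X 1) := by
  obtain ⟨c, hc⟩ := hf.eq_sum {(2 * n + 1, 0), (n, 1)} fun a b h => by
    simp only [Matrix.cons_val_zero, Matrix.cons_val_one, Matrix.cons_val_fin_one] at h
    have hb : b < 2 := by
      by_contra! hb
      have : (2 : ℤ) * (n + 1) ≤ (n + 1 : ℤ) * b := by nlinarith
      push_cast at h
      omega
    simp only [Finset.mem_insert, Finset.mem_singleton, Prod.mk.injEq]
    interval_cases b <;> push_cast at h <;> omega
  refine ⟨c (2 * n + 1, 0), c (n, 1), ?_⟩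
  rw [hc, Finset.sum_pair (by simp)]
  simp

/-- Parity excludes a pure power of `x`, and `y ^ 2` is already too heavy. -/
theorem IsQuasiHom.eq_of_cusp_fst (hf : IsQuasiHom ![2, 2 * n + 1] (2 * n + 1) f) :
    ∃ b : ℝ, f = C b * X 1 := by
  obtain ⟨c, hc⟩ := hf.eq_sum {(0, 1)} fun a b h => by
    simp only [Matrix.cons_val_zero, Matrix.cons_val_one, Matrix.cons_val_fin_one] at h
    have hb : b < 2 := by
      by_contra! hb
      have : (2 : ℤ) * (2 * n + 1) ≤ (2 * n + 1 : ℤ) * b := by nlinarith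
      push_cast at h
      omega
    simp only [Finset.mem_singleton, Prod.mk.injEq]
    interval_cases b <;> push_cast at h <;> omega
  refine ⟨c (0, 1), ?_⟩
  rw [hc, Finset.sum_singleton]
  simp

theorem IsQuasiHom.eq_of_cusp_snd (hf : IsQuasiHom ![2, 2 * n + 1] (4 * n) f) :
    ∃ c : ℝ, f = C c * X 0 ^ (2 * n) := by
  obtain ⟨c, hc⟩ := hf.eq_sum {(2 * n, 0)} fun a b h => by
    simp only [Matrix.cons_val_zero, Matrix.cons_val_one, Matrix.cons_val_fin_one] at h
    have hb : b < 2 := by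
      by_contra! hb
      have : (2 : ℤ) * (2 * n + 1) ≤ (2 * n + 1 : ℤ) * b := by nlinarith
      push_cast at h
      omega
    simp only [Finset.mem_singleton, Prod.mk.injEq]
    interval_cases b <;> push_cast at h <;> omega
  refine ⟨c (2 * n, 0), ?_⟩
  rw [hc, Finset.sum_singleton]
  simp

end LeadingPart

/-- The types for which the leading part of a nilpotent field can have an isolated zero. -/
theorem HasQuasiHomExpansion.type_eq {t : Fin 2 → ℕ} (ht : ∀ i, 0 < t i)
    (hcop : Nat.Coprime (t 0) (t 1)) (hle : t 0 ≤ t 1) {r : ℤ} {F : Plane → Plane}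
    {V : ℕ → PolyField} (h : HasQuasiHomExpansion t r F V) (hnil : IsNilpotentSingularity F)
    (hiso : IsIsolatedSingularity (V 0).toMap) :
    ∃ n : ℕ, 1 ≤ n ∧
      ((t = ![2, 2 * n + 1] ∧ r = 2 * n - 1) ∨ (t = ![1, n + 1] ∧ r = n)) := by
  obtain ⟨hlt, hr⟩ := h.degree_eq ht hcop hle hnil hiso
  have hq : IsQuasiHomField t r (V 0) := by simpa using h.quasiHom 0
  have hz : ∀ i, eval 0 (V 0 i) = 0 := fun i => congrFun hiso.1 i
  -- On the x-axis some component contains `x ^ γ`: either `γ t₀ = t₁` or `γ t₀ = 2 t₁ - t₀`. In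
  -- both cases `t₀` divides `2 t₁`.
  have hdvd : t 0 ∣ 2 := by
    obtain ⟨i, hi⟩ := Function.ne_iff.1 (hiso.ne_zero ht hq (p := Pi.single 0 1) (by simp))
    obtain ⟨γ, -, hγ⟩ := (hq i).degree_of_eval_single (hz i) hi
    refine hcop.dvd_of_dvd_mul_right ?_
    rw [← Int.natCast_dvd_natCast]
    fin_cases i
    · refine ⟨2 * γ, ?_⟩
      simp only [Fin.zero_eta] at hγ
      push_cast
      linear_combination 2 * hγ - 2 * hr
    · refine ⟨γ + 1, ?_⟩
      simp only [Fin.mk_one] at hγ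
      push_cast
      linear_combination hγ - hr
  have hext : ∀ a b : ℕ, t 0 = a → t 1 = b → t = ![a, b] := fun a b ha hb => by
    funext i
    fin_cases i <;> simp [ha, hb]
  rcases (Nat.dvd_prime Nat.prime_two).1 hdvd with h0 | h0
  · obtain ⟨n, hn⟩ := Nat.exists_eq_add_of_lt hlt
    refine ⟨n + 1, by omega, Or.inr ⟨hext _ _ h0 (by omega), ?_⟩⟩
    omega
  · rw [h0] at hcop
    obtain ⟨n, hn⟩ := (Nat.coprime_two_left).1 hcop
    refine ⟨n, by omega, Or.inl ⟨hext _ _ h0 hn, ?_⟩⟩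
    omega

/-- If a shear carries the leading part of an expansion to `N`, then `N` inherits the absence of
nontrivial zeros and the first integrals of the leading part. -/
theorem HasQuasiHomExpansion.exists_shear {t : Fin 2 → ℕ} (ht : ∀ i, 0 < t i) {r : ℤ}
    {F : Plane → Plane} {V : ℕ → PolyField} (h : HasQuasiHomExpansion t r F V)
    (hiso : IsIsolatedSingularity (V 0).toMap) {M : ℕ} {J : PlanePoly} (hJ0 : J ≠ 0)
    (hJ : IsQuasiHom t M J) (hJL : (V 0).lieDeriv J = 0) {N : PolyField} {α β γ : ℝ} {m : ℕ}
    (hα : α ≠ 0) (hβ : β ≠ 0) (hγ : γ = 0 ∨ t 1 = m * t 0)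
    (hN : ∀ i, (V 0).lieDeriv (shear α β γ m i) = bind₁ (shear α β γ m) (N i)) :
    (∃ Φ : PolyField, IsQuasiHomField t 0 Φ ∧ (Φ.jacobian 0).det ≠ 0 ∧
      ∃ (G : Plane → Plane) (W : ℕ → PolyField),
        IsPushforward Φ F G ∧ HasQuasiHomExpansion t r G W ∧ W 0 = N) ∧
      (∀ q, q ≠ 0 → N.toMap q ≠ 0) ∧
      ∃ J' : PlanePoly, J' ≠ 0 ∧ IsQuasiHom t M J' ∧ N.lieDeriv J' = 0 := by
  have hΦ := isQuasiHomField_shear α β hγ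
  have hΨ : IsQuasiHomField t 0 (shear α⁻¹ β⁻¹ (-(β⁻¹ * γ * α⁻¹ ^ m)) m) :=
    isQuasiHomField_shear _ _ (hγ.imp_left fun h => by simp [h])
  have h₁ := shear_comp (γ := γ) hα hβ m
  have h₂ := shear_comp' (γ := γ) hα hβ m
  have hq : IsQuasiHomField t r (V 0) := by simpa using h.quasiHom 0
  obtain ⟨G, hG, hW⟩ := h.pushforward ht hΦ hΨ h₁
  refine ⟨⟨_, hΦ, det_jacobian_shear hα hβ γ m 0, G, _, hG, hW, funext fun i => ?_⟩,
    toMap_ne_zero_transfer hN h₁ h₂ (toMap_zero_of_isQuasiHomField ht hΦ)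
      fun p hp => hiso.ne_zero ht hq hp,
    bind₁ (shear α⁻¹ β⁻¹ (-(β⁻¹ * γ * α⁻¹ ^ m)) m) J, fun h0 => hJ0 ?_, hJ.bind₁ hΨ, ?_⟩
  · rw [hN, bind₁_bind₁_of_inverse h₂]
  · rw [← bind₁_bind₁_of_inverse h₁ J, h0, map_zero]
  · rw [lieDeriv_transfer hN h₁ h₂, hJL, map_zero]

theorem PolyField.lieDeriv_shear_zero (V : PolyField) (α β γ : ℝ) (m : ℕ) :
    V.lieDeriv (shear α β γ m 0) = C α * V 0 := by
  change V.lieDeriv (C α * X 0) = _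
  rw [lieDeriv_C_mul, lieDeriv_X]

theorem PolyField.lieDeriv_shear_one (V : PolyField) (α β γ : ℝ) (m : ℕ) :
    V.lieDeriv (shear α β γ m 1) =
      C β * V 1 + C γ * ((m : PlanePoly) * X 0 ^ (m - 1) * V 0) := by
  change V.lieDeriv (C β * X 1 + C γ * X 0 ^ m) = _
  rw [lieDeriv_add, lieDeriv_C_mul, lieDeriv_C_mul, lieDeriv_X, lieDeriv_pow, lieDeriv_X]

theorem exists_shear_cusp {n : ℕ} (hn : 1 ≤ n) {r : ℤ} (hr : r = 2 * n - 1) {V : PolyField}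
    (hV : IsQuasiHomField ![2, 2 * n + 1] r V) (hne : ∀ p, p ≠ 0 → V.toMap p ≠ 0) :
    ∃ α β : ℝ, α ≠ 0 ∧ β ≠ 0 ∧ ∀ i, V.lieDeriv (shear α β 0 0 i) =
      bind₁ (shear α β 0 0) ((![X 1, X 0 ^ (2 * n)] : PolyField) i) := by
  have hV0 := hV 0
  have hV1 := hV 1
  simp only [Matrix.cons_val_zero, Matrix.cons_val_one, Matrix.cons_val_fin_one, hr] at hV0 hV1
  push_cast at hV0 hV1
  rw [show (2 * n - 1 : ℤ) + 2 = 2 * n + 1 by ring] at hV0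
  rw [show (2 * n - 1 : ℤ) + (2 * n + 1) = 4 * n by ring] at hV1
  obtain ⟨b, hb⟩ := hV0.eq_of_cusp_fst
  obtain ⟨c, hc⟩ := hV1.eq_of_cusp_snd
  have hb0 : b ≠ 0 := by
    rintro rfl
    refine hne ![0, 1] (by simp) (funext fun i => ?_)
    fin_cases i <;> simp [PolyField.toMap, hb, hc]
    omega
  have hc0 : c ≠ 0 := by
    rintro rfl
    refine hne ![1, 0] (by simp) (funext fun i => ?_)
    fin_cases i <;> simp [PolyField.toMap, hb, hc]
  obtain ⟨k, rfl⟩ := Nat.exists_eq_add_of_le' hn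
  -- Matching the components requires `β = α b` and `α ^ (2n - 1) = b c`. The exponent is odd, so no
  -- sign remains.
  obtain ⟨α, hα⟩ := exists_pow_odd_eq k (b * c)
  have hα0 : α ≠ 0 := by
    rintro rfl
    rw [zero_pow (by omega)] at hα
    exact mul_ne_zero hb0 hc0 hα.symm
  refine ⟨α, α * b, hα0, mul_ne_zero hα0 hb0, fun i => MvPolynomial.funext fun p => ?_⟩
  fin_cases i
  · simp only [Fin.zero_eta, PolyField.lieDeriv_shear_zero]
    simp [shear, hb]
    ring
  · simp only [Fin.mk_one, PolyField.lieDeriv_shear_one]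
    simp [shear, hc, mul_pow, mul_add, pow_succ] at hα ⊢
    linear_combination (-α * (p 0 ^ (2 * k) * p 0 * p 0)) * hα

theorem exists_shear_node {n : ℕ} (hn : 1 ≤ n) {r : ℤ} (hr : r = n) {V : PolyField}
    (hV : IsQuasiHomField ![1, n + 1] r V) (hne : ∀ p, p ≠ 0 → V.toMap p ≠ 0) :
    ∃ α β γ s d : ℝ, α ≠ 0 ∧ β ≠ 0 ∧ (s = 0 ∨ s = 1 ∨ s = -1) ∧
      ∀ i, V.lieDeriv (shear α β γ (n + 1) i) =
        bind₁ (shear α β γ (n + 1)) (nodeField n s d i) := by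
  have hV0 := hV 0
  have hV1 := hV 1
  simp only [Matrix.cons_val_zero, Matrix.cons_val_one, Matrix.cons_val_fin_one, hr] at hV0 hV1
  push_cast at hV0 hV1
  rw [show (n : ℤ) + (n + 1) = 2 * n + 1 by ring] at hV1
  obtain ⟨b, a, hb⟩ := hV0.eq_of_node_fst
  obtain ⟨c, e, hc⟩ := hV1.eq_of_node_snd
  have hb0 : b ≠ 0 := by
    rintro rfl
    refine hne ![0, 1] (by simp) (funext fun i => ?_)
    have hn0 : n ≠ 0 := by omega
    fin_cases i <;> simp [PolyField.toMap, hb, hc, hn0]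
  have hn1 : (n : ℝ) + 1 ≠ 0 := by positivity
  -- The field `δ x^n (x, (n+1) y)` carries the whole divergence `((n+1) a + e) x^n` of `V`. The
  -- shear coefficient `α (a - δ)` then absorbs the rest of the `x^(n+1)` term.
  obtain ⟨δ, hδ⟩ : ∃ δ : ℝ, 2 * (n + 1) * δ = (n + 1) * a + e :=
    ⟨((n + 1) * a + e) / (2 * (n + 1)), by field_simp⟩
  -- The coefficient of `x^(2n+1)` scales by the even power `α ^ (2n)`, so its sign `s` survives.
  obtain ⟨s, α, hα, hs, hsα⟩ := exists_sign_mul_pow (n := 2 * n) (by omega)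
    ((b * c + (n + 1) * (a - δ) ^ 2) / (n + 1))
  rw [div_eq_iff hn1] at hsα
  obtain ⟨d, hd⟩ : ∃ d : ℝ, δ = d * α ^ n := ⟨δ / α ^ n, by field_simp⟩
  refine ⟨α, α * b, α * (a - δ), s, d, hα.ne', mul_ne_zero hα.ne' hb0, hs,
    fun i => MvPolynomial.funext fun p => ?_⟩
  fin_cases i
  · simp only [Fin.zero_eta, PolyField.lieDeriv_shear_zero]
    simp [shear, nodeField, hb, mul_pow]
    linear_combination (α * p 0 ^ (n + 1)) * hd
  · simp only [Fin.mk_one, PolyField.lieDeriv_shear_one]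
    simp [shear, nodeField, hb, hc, mul_pow]
    have h2 : ∀ x : ℝ, x ^ (2 * n) = (x ^ n) ^ 2 := fun x => by rw [mul_comm, pow_mul]
    simp only [pow_succ _ n, pow_succ _ (2 * n), h2] at hsα ⊢
    linear_combination (α * p 0 * (p 0 ^ n) ^ 2) * hsα -
      (α * b * p 0 ^ n * p 1) * hδ +
      ((n + 1) * α * p 0 ^ n * (b * p 1 + (a - δ) * p 0 ^ n * p 0)) * hd

/-! ### Admissible parameters and conclusion -/

/-- The parameters of a normal form without nontrivial zeros that has a first integral. -/
theorem nodeField_parameters {n : ℕ} {s d : ℝ} (hs : s = 0 ∨ s = 1 ∨ s = -1)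
    (hne : ∀ q, q ≠ 0 → (nodeField n s d).toMap q ≠ 0) {M : ℕ} (hM : 0 < M) {J : PlanePoly}
    (hJ0 : J ≠ 0) (hJ : IsQuasiHom ![1, n + 1] M J) (hL : (nodeField n s d).lieDeriv J = 0) :
    ((s = 1 ∨ s = -1) ∧ d = 0) ∨ (s = 1 ∧ d ≠ 0 ∧ ∃ m₁ m₂ : ℕ, 0 < m₁ ∧ 0 < m₂ ∧
      Nat.Coprime m₁ m₂ ∧ d = ((m₁ : ℝ) - m₂) / ((m₁ : ℝ) + m₂)) := by
  have hMR : (0 : ℝ) < M := by exact_mod_cast hM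
  have hn : (0 : ℝ) < n + 1 := by positivity
  rcases hs with rfl | rfl | rfl
  · exfalso
    have h := degree_mul_eq_zero_of_nodeField_zero hJ hJ0 hL
    have hd : d = 0 := by simpa [hM.ne'] using h
    subst hd
    refine hne ![1, 0] (by simp) (funext fun i => ?_)
    fin_cases i <;> simp [PolyField.toMap, nodeField]
  · rcases eq_or_ne d 0 with hd | hd
    · exact Or.inl ⟨Or.inl rfl, hd⟩
    refine Or.inr ⟨rfl, hd, ?_⟩
    obtain ⟨a, b, ha, hb⟩ := multiplicities_of_nodeField_one hJ hJ0 hL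
    push_cast at ha hb
    -- If a multiplicity is zero, then `d = ±1` and the field vanishes along one of the curves `y =
    -- ±x^(n+1)`, which contradicts the isolated zero.
    have ha0 : a ≠ 0 := by
      rintro rfl
      have hd1 : d = -1 := by
        have : (M : ℝ) * (1 + d) = 0 := by rw [← ha]; simp
        linarith [(mul_eq_zero.1 this).resolve_left hMR.ne']
      subst hd1
      refine hne ![1, 1] (by simp) (funext fun i => ?_)
      fin_cases i <;> simp [PolyField.toMap, nodeField]
    have hb0 : b ≠ 0 := by
      rintro rfl
      have hd1 : d = 1 := by
        have : (M : ℝ) * (1 - d) = 0 := by rw [← hb]; simp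
        linarith [(mul_eq_zero.1 this).resolve_left hMR.ne']
      subst hd1
      refine hne ![1, -1] (by simp) (funext fun i => ?_)
      fin_cases i <;> simp [PolyField.toMap, nodeField]
    obtain ⟨m₁, m₂, hco, h1, h2⟩ := Nat.exists_coprime a b
    have hg : 0 < a.gcd b := Nat.gcd_pos_of_pos_left _ (Nat.pos_of_ne_zero ha0)
    generalize a.gcd b = g at h1 h2 hg
    subst h1 h2
    have hm₁ : 0 < m₁ := Nat.pos_of_ne_zero fun h => ha0 (by simp [h])
    have hm₂ : 0 < m₂ := Nat.pos_of_ne_zero fun h => hb0 (by simp [h])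
    refine ⟨m₁, m₂, hm₁, hm₂, hco, ?_⟩
    have hm : (0 : ℝ) < m₁ + m₂ := by positivity
    have hgR : (0 : ℝ) < g := by exact_mod_cast hg
    rw [eq_div_iff hm.ne']
    -- Adding the two residue identities gives the degree; their difference gives `M d`, hence `d`.
    have hsum : (M : ℝ) = g * (n + 1) * (m₁ + m₂) := by
      push_cast at ha hb
      linear_combination -(ha + hb) / 2
    apply mul_left_cancel₀ (mul_pos hgR hn).ne'
    push_cast at ha hb
    linear_combination -d * hsum - (ha - hb) / 2
  · refine Or.inl ⟨Or.inr rfl, ?_⟩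
    simpa [hM.ne'] using (degree_of_nodeField_neg_one hJ hJ0 hL).1

theorem mainTheorem4 (t : Fin 2 → ℕ) (ht : ∀ i, 0 < t i) (hcop : Nat.Coprime (t 0) (t 1))
    (hle : t 0 ≤ t 1) (r : ℤ) (F : Plane → Plane) (V : ℕ → PolyField)
    (hexp : HasQuasiHomExpansion t r F V) (hnil : IsNilpotentSingularity F)
    (hiso : IsIsolatedSingularity (V 0).toMap) (hint : IsAnalyticallyIntegrable F) :
    ∃ Φ : PolyField, IsQuasiHomField t 0 Φ ∧ (Φ.jacobian 0).det ≠ 0 ∧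
      ∃ (G : Plane → Plane) (W : ℕ → PolyField),
        IsPushforward Φ F G ∧ HasQuasiHomExpansion t r G W ∧
        ∃ n : ℕ, 1 ≤ n ∧
          ((t = ![2, 2 * n + 1] ∧ r = 2 * n - 1 ∧
              W 0 = ![X 1, X 0 ^ (2 * n)] ∧
              IsPrimitiveFirstIntegral t (W 0) (2 * (2 * n + 1))
                (2 * X 0 ^ (2 * n + 1) - C (2 * n + 1 : ℝ) * X 1 ^ 2)) ∨
            (t = ![1, n + 1] ∧ r = n ∧
              ∃ σ : ℝ, (σ = 1 ∨ σ = -1) ∧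
                W 0 = ![X 1, C (σ * (n + 1)) * X 0 ^ (2 * n + 1)] ∧
                IsPrimitiveFirstIntegral t (W 0) (2 * (n + 1))
                  (-C σ * X 0 ^ (2 * n + 2) + X 1 ^ 2)) ∨
            (t = ![1, n + 1] ∧ r = n ∧
              ∃ (m₁ m₂ : ℕ) (d : ℝ), 0 < m₁ ∧ 0 < m₂ ∧ Nat.Coprime m₁ m₂ ∧
                d = ((m₁ : ℝ) - m₂) / ((m₁ : ℝ) + m₂) ∧ d ≠ 0 ∧
                W 0 = ![X 1 + C d * X 0 ^ n * X 0,
                  C (n + 1 : ℝ) * X 0 ^ (2 * n + 1) + C d * X 0 ^ n * (C (n + 1 : ℝ) * X 1)] ∧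
                IsPrimitiveFirstIntegral t (W 0) ((n + 1) * (m₁ + m₂))
                  ((X 1 - X 0 ^ (n + 1)) ^ m₁ * (X 1 + X 0 ^ (n + 1)) ^ m₂))) := by
  obtain ⟨n, hn, hcase⟩ := hexp.type_eq ht hcop hle hnil hiso
  obtain ⟨M, J, hM, hJ0, hJ, hJL⟩ := hint.exists_quasiHom ht hexp
  have hq : IsQuasiHomField t r (V 0) := by simpa using hexp.quasiHom 0
  have hne : ∀ p, p ≠ 0 → (V 0).toMap p ≠ 0 := fun p hp => hiso.ne_zero ht hq hp
  rcases hcase with ⟨rfl, hr⟩ | ⟨rfl, hr⟩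
  · obtain ⟨α, β, hα, hβ, hN⟩ := exists_shear_cusp hn hr hq hne
    obtain ⟨⟨Φ, hΦ, hdet, G, W, hG, hW, hW0⟩, -⟩ :=
      hexp.exists_shear ht hiso hJ0 hJ hJL hα hβ (Or.inl rfl) hN
    refine ⟨Φ, hΦ, hdet, G, W, hG, hW, n, hn, Or.inl ⟨rfl, hr, hW0, ?_⟩⟩
    rw [hW0]
    exact isPrimitiveFirstIntegral_cusp n
  · obtain ⟨α, β, γ, s, d, hα, hβ, hs, hN⟩ := exists_shear_node hn hr hq hne
    obtain ⟨⟨Φ, hΦ, hdet, G, W, hG, hW, hW0⟩, hNne, J', hJ0', hJ', hJL'⟩ :=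
      hexp.exists_shear ht hiso hJ0 hJ hJL hα hβ (Or.inr (by simp)) hN
    refine ⟨Φ, hΦ, hdet, G, W, hG, hW, n, hn, Or.inr ?_⟩
    rcases nodeField_parameters hs hNne hM hJ0' hJ' hJL' with
      ⟨hs1, rfl⟩ | ⟨rfl, hd, m₁, m₂, hm₁, hm₂, hco, hdm⟩
    · refine Or.inl ⟨rfl, hr, s, hs1, by rw [hW0, nodeField_zero_right], ?_⟩
      rw [hW0]
      exact isPrimitiveFirstIntegral_nodeField_zero n hs1
    · refine Or.inr ⟨rfl, hr, m₁, m₂, d, hm₁, hm₂, hco, hdm, hd, ?_, ?_⟩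
      · rw [hW0, nodeField, one_mul]
      · rw [hW0]
        exact isPrimitiveFirstIntegral_nodeField_one n hm₁ hco hdm
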